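/- A (nondeterministic Turing) machine is a tuple $M=\langle Q,\Gamma,\delta\rangle$ with a finite set $Q$ of states containing the initial state $q_0$, a finite tape alphabet $\Gamma\supseteq\{0,1\}$ that does not contain the blank $\mathtt B$, and a transition function $\delta : Q\times(\Gamma\cup\{\mathtt B\})\to\mathcal P(Q\times\Gamma\times\{\leftarrow,\rightarrow\})$. A configuration is a tuple $\langle n,t,p,q\rangle$ with $n\ge 1$, a tape $t:\{1,\dots,n\}\to\Gamma\cup\{\mathtt B\}$ such that $t(n)=\mathtt B$ and $t(i)=\mathtt B$ implies $t(i+1)=\mathtt B$ for $1\le i<n$, a head position $p\in\{1,\dots,n\}$ and a state $q\in Q$. Its successor configurations are the configurations $\langle n+1,t',p',r\rangle$ for which there is some $\langle r,a,d\rangle\in\delta(t(p),q)$ with $d={\rightarrow}$ or $p\ge 2$, such that $t'(p)=a$, $t'(n+1)=\mathtt B$, $t'(i)=t(i)$ for all other $i$, and $p'=p+1$ if $d={\rightarrow}$, $p'=p-1$ if $d={\leftarrow}$. A run of $M$ on a configuration $\rho$ is a finite or infinite sequence of configurations that starts with $\rho$, in which each further element is a successor of the preceding one, and which, if finite, ends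 in a configuration without successors. A run on a word $w=w_1\cdots w_\ell\in\{0,1\}^*$ is a run on the starting configuration $\langle \ell+1,\,w_1\cdots w_\ell\mathtt B,\,1,\,q_0\rangle$. Let $q_r\in Q$. The machine $M$ is *non-recurring through $q_r$ on $w$* if every run of $M$ on $w$ features $q_r$ only finitely many times; *universally non-recurring through $q_r$* if it is non-recurring through $q_r$ on every word $w\in\{0,1\}^*$; and *robust non-recurring through $q_r$* if every run of $M$ on any configuration features $q_r$ only finitely many times. **Proposition.** Each of the following three decision problems, whose input is a pair $(M,q_r)$ of a machine and one of its states, is $\Pi^1_1$-complete: 1. Is $M$ non-recurring through $q_r$ on the empty word $\varepsilon$? 2. Is $M$ universally non-recurring through $q_r$? 3. Is $M$ robust non-recurring through $q_r$? Here a problem is identified with the set of natural numbers coding its positive instances (under a standard effective coding of pairs $(M,q_r)$). A set $A\subseteq\mathbb N$ is $\Pi^1_1$ if it can be defined in the standard model of arithmetic by a formula $\forall X_1\cdots\forall X_k\,\varphi(x,X_1,\dots,X_k)$, with set variables $X_i$ ranging over subsets of $\mathbb N$ and $\varphi$ a formula of arithmetic without set quantifiers; and $A$ is $\Pi^1_1$-complete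 if it is $\Pi^1_1$ and every $\Pi^1_1$ set is many-one reducible to $A$ by a computable function. -/

import Mathlib

/-! ### The class `Π¹₁` and completeness -/

/-- Function symbols of arithmetic: `0`, `1`, `+`, `·`. -/
inductive ArithFunc : ℕ → Type
  | zero : ArithFunc 0
  | one : ArithFunc 0
  | add : ArithFunc 2
  | mul : ArithFunc 2

/-- Relation symbols: a unary symbol for each second-order (set) variable `X₀, X₁, …`; the atomic
formula `set i t` is read `t ∈ Xᵢ`. -/
inductive ArithRel : ℕ → Type
  | set (i : ℕ) : ArithRel 1

/-- The language of second-order arithmetic.  Its first-order formulas are the formulas of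
second-order arithmetic without set quantifiers. -/
def arithLang : FirstOrder.Language := ⟨ArithFunc, ArithRel⟩

/-- The standard model `(ℕ, 0, 1, +, ·)`, with the set variable `Xᵢ` interpreted by `X i`. -/
@[reducible]
def natModel (X : ℕ → Set ℕ) : arithLang.Structure ℕ where
  funMap := fun {_} f =>
    match f with
    | ArithFunc.zero => fun _ => 0
    | ArithFunc.one => fun _ => 1
    | ArithFunc.add => fun v => v 0 + v 1
    | ArithFunc.mul => fun v => v 0 * v 1
  RelMap := fun {_} R =>
    match R with
    | ArithRel.set i => fun v => v 0 ∈ X i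

/-- `A ⊆ ℕ` is `Π¹₁`: there is a formula `φ(x, X₀, X₁, …)` without set quantifiers such that
`n ∈ A` iff `∀ X₀ X₁ …, φ(n, X₀, X₁, …)` holds in the standard model.  Only finitely many set
variables occur in `φ`, so this is a finite block of universal set quantifiers. -/
def IsPi11 (A : Set ℕ) : Prop :=
  ∃ φ : arithLang.Formula Unit, ∀ n : ℕ,
    n ∈ A ↔ ∀ X : ℕ → Set ℕ,
      @FirstOrder.Language.Formula.Realize arithLang ℕ (natModel X) Unit φ (fun _ => n)

/-- `A` is `Π¹₁`-complete: it is `Π¹₁`, and every `Π¹₁` set is many-one reducible to it by a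
computable function. -/
def IsPi11Complete (A : Set ℕ) : Prop :=
  IsPi11 A ∧ ∀ B : Set ℕ, IsPi11 B → ManyOneReducible (fun n => n ∈ B) (fun n => n ∈ A)

/-! ### Nondeterministic Turing machines -/

/-- Moves of the head. -/
inductive Dir
  | left
  | right

/-- A nondeterministic Turing machine `⟨Q, Γ, δ⟩`.  As states and symbols only matter up to
renaming, `Q = {0, …, k}` with initial state `0`, and `Γ = {0, …, m + 1}`, which contains `0` and
`1`.  The blank, which does not belong to `Γ` and cannot be written, is `none : Option Γ`. -/
structure NDTM where
  k : ℕ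
  m : ℕ
  δ : Option (Fin (m + 2)) → Fin (k + 1) → Set (Fin (k + 1) × Fin (m + 2) × Dir)

namespace NDTM

/-- The set `Q` of states. -/
abbrev State (M : NDTM) : Type := Fin (M.k + 1)

/-- The tape alphabet `Γ`. -/
abbrev Symbol (M : NDTM) : Type := Fin (M.m + 2)

/-- A configuration `⟨n, t, p, q⟩`.  Tape positions are `1, …, n`; the function `t` on
`{1, …, n}` is extended by the blank to all of `ℕ`, to have a unique representation. -/
structure Config (M : NDTM) where
  n : ℕ
  t : ℕ → Option M.Symbol
  p : ℕ
  q : M.State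
  outside : ∀ i, i = 0 ∨ n < i → t i = none
  last_blank : t n = none
  blank_succ : ∀ i, 1 ≤ i → i < n → t i = none → t (i + 1) = none
  one_le_p : 1 ≤ p
  p_le_n : p ≤ n

/-- `M.Next ρ` is the set of all configurations `⟨n + 1, t', p', r⟩` that arise from
`ρ = ⟨n, t, p, q⟩` by some `⟨r, a, d⟩ ∈ δ(t(p), q)`, where a left move needs `p ≥ 2`, and `t'` is
`t` with `a` written at `p` and a blank at the new position `n + 1`. -/
def Next (M : NDTM) (ρ : M.Config) : Set M.Config :=
  {ρ' | ∃ r a d, (r, a, d) ∈ M.δ (ρ.t ρ.p) ρ.q ∧ (d = Dir.right ∨ 2 ≤ ρ.p) ∧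
    ρ'.n = ρ.n + 1 ∧
    ρ'.t = Function.update ρ.t ρ.p (some a) ∧
    ρ'.p = (match d with
      | Dir.left => ρ.p - 1
      | Dir.right => ρ.p + 1) ∧
    ρ'.q = r}

/-- The possibly infinite sequence `S` (`none` from its end on) is a run of `M` on `ρ₁`. -/
def IsRun (M : NDTM) (ρ₁ : M.Config) (S : ℕ → Option M.Config) : Prop :=
  S 0 = some ρ₁ ∧
  (∀ i, S i = none → S (i + 1) = none) ∧
  ∀ i ρ, S i = some ρ →
    (∃ ρ' ∈ M.Next ρ, S (i + 1) = some ρ') ∨ (M.Next ρ = ∅ ∧ S (i + 1) = none)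

/-- Every run of `M` on `ρ` features the state `qr` only finitely many times. -/
def NonRecurringFrom (M : NDTM) (qr : M.State) (ρ : M.Config) : Prop :=
  ∀ S, M.IsRun ρ S → {i | ∃ ρ', S i = some ρ' ∧ ρ'.q = qr}.Finite

/-- The letter `0` or `1` as a tape symbol. -/
def bit (M : NDTM) (b : Bool) : M.Symbol := if b then 1 else 0

/-- The contents `w₁ … wₗ B` of the tape for the input word `w`. -/
def inputTape (M : NDTM) (w : List Bool) : ℕ → Option M.Symbol
  | 0 => none
  | i + 1 => (w[i]?).map M.bit

/-- The starting configuration `⟨|w| + 1, w₁ … wₗ B, 1, q₀⟩` on the word `w`. -/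
def start (M : NDTM) (w : List Bool) : M.Config where
  n := w.length + 1
  t := M.inputTape w
  p := 1
  q := 0
  outside := by
    rintro (_ | i) hi
    · rfl
    · have h : w.length ≤ i := by omega
      simp [inputTape, h]
  last_blank := by simp [inputTape]
  blank_succ := by
    rintro (_ | i) h1 _ h
    · omega
    · simp only [inputTape, Option.map_eq_none_iff, List.getElem?_eq_none_iff] at h ⊢
      omega
  one_le_p := le_rfl
  p_le_n := by omega

/-- `M` is non-recurring through `qr` on the word `w`. -/
def NonRecurringOn (M : NDTM) (qr : M.State) (w : List Bool) : Prop :=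
  M.NonRecurringFrom qr (M.start w)

/-- `M` is universally non-recurring through `qr`. -/
def UniversallyNonRecurring (M : NDTM) (qr : M.State) : Prop :=
  ∀ w : List Bool, M.NonRecurringOn qr w

/-- `M` is robust non-recurring through `qr`. -/
def RobustNonRecurring (M : NDTM) (qr : M.State) : Prop :=
  ∀ ρ : M.Config, M.NonRecurringFrom qr ρ

/-! ### The decision problems as sets of codes -/

/-- The transition `⟨r, a, d⟩ ∈ δ(s, q)` written as a tuple of numbers. -/
def transitionCode (M : NDTM) :
    M.State × Option M.Symbol × M.State × M.Symbol × Dir → ℕ × Option ℕ × ℕ × ℕ × Bool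
  | (q, s, r, a, d) =>
    (q.val, s.map Fin.val, r.val, a.val,
      match d with
      | Dir.left => false
      | Dir.right => true)

/-- `c` is a code of the pair `(M, qr)`: it is the number of `(k, m, qr, l)` for some list `l` of
all transitions of `M` (in any order, repetitions allowed). -/
def IsCode (c : ℕ) (M : NDTM) (qr : M.State) : Prop :=
  ∃ l : List (M.State × Option M.Symbol × M.State × M.Symbol × Dir),
    (∀ q s r a d, (q, s, r, a, d) ∈ l ↔ (r, a, d) ∈ M.δ s q) ∧
    c = Encodable.encode (M.k, M.m, qr.val, l.map M.transitionCode)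

/-- The set of all codes of pairs `(M, qr)` with the property `P`. -/
def codesOf (P : (M : NDTM) → M.State → Prop) : Set ℕ :=
  {c | ∃ (M : NDTM) (qr : M.State), IsCode c M qr ∧ P M qr}

end NDTM

/-!
An infinite computation can be coded by a function `ℕ → ℕ`, and it is an arithmetical property of
this function that it codes a computation which visits `qr` infinitely often. Hence each of the
three problems is of the form "no function has a certain arithmetical property", which is `Π¹₁`.

For hardness, Skolem functions turn the complement of a `Π¹₁` set `B` into the set of all `n` for
which some tree, primitive recursive in `n`, has an infinite branch. With nodes coded by numbers
there is a primitive recursive `T` such that `n ∉ B` if and only if there is an infinite chain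
`T n (σ i) (σ (i + 1))`, in which case the chain can begin with the root `0`. The machine for `n`
works in rounds: it keeps a number `s`, guesses a number `y` by incrementing a counter until it
decides to stop, checks `T n s y`, and if this holds visits the distinguished state and begins the
next round with `y` in place of `s`. Runs in which a guess never ends or a check fails visit this
state only finitely often, so recurring runs are infinite chains.

The counters are kept on the tape as unary numbers, written with bits on parallel tracks to the
right of a marked cell. Whatever stands to the right of such a cell represents some counter values,
so even a recurring run from an arbitrary configuration yields an infinite chain, though not one
that begins with the root. Therefore `n ∈ B` makes the machine robust non-recurring, whereas `n ∉ B`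
makes it recurring on the empty word, and this settles the three problems simultaneously.
-/

section Definability

open FirstOrder FirstOrder.Language

/-- The relation `R` between set variables and numbers is defined in the standard model by a single
formula of arithmetic without set quantifiers. -/
def ArithDefinable {α : Type*} (R : (ℕ → Set ℕ) → (α → ℕ) → Prop) : Prop :=
  ∃ φ : arithLang.Formula α, ∀ X v, @Formula.Realize arithLang ℕ (natModel X) α φ v ↔ R X v

/-- The graph of the function `h` of set variables and numbers is arithmetically definable; the
variable `Sum.inr ()` stands for the value. -/
def ArithDefinableFun {α : Type*} (h : (ℕ → Set ℕ) → (α → ℕ) → ℕ) : Prop :=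
  ArithDefinable fun X (v : α ⊕ Unit → ℕ) => v (.inr ()) = h X fun i => v (.inl i)

namespace ArithDefinable

variable {α β : Type*} {R S : (ℕ → Set ℕ) → (α → ℕ) → Prop}

theorem of_iff (hR : ArithDefinable R) (h : ∀ X v, S X v ↔ R X v) : ArithDefinable S :=
  let ⟨φ, hφ⟩ := hR
  ⟨φ, fun X v => (hφ X v).trans (h X v).symm⟩

theorem not (hR : ArithDefinable R) : ArithDefinable fun X v => ¬R X v := by
  obtain ⟨φ, hφ⟩ := hR
  refine ⟨φ.not, fun X v => ?_⟩
  let _ := natModel X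
  rw [Formula.realize_not, hφ]

theorem and (hR : ArithDefinable R) (hS : ArithDefinable S) :
    ArithDefinable fun X v => R X v ∧ S X v := by
  obtain ⟨φ, hφ⟩ := hR
  obtain ⟨ψ, hψ⟩ := hS
  refine ⟨φ ⊓ ψ, fun X v => ?_⟩
  let _ := natModel X
  rw [Formula.realize_inf, hφ, hψ]

theorem imp (hR : ArithDefinable R) (hS : ArithDefinable S) :
    ArithDefinable fun X v => R X v → S X v :=
  (hR.and hS.not).not.of_iff fun X v => by tauto

theorem or (hR : ArithDefinable R) (hS : ArithDefinable S) :
    ArithDefinable fun X v => R X v ∨ S X v :=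
  (hR.not.and hS.not).not.of_iff fun X v => by tauto

theorem forall_fin [Finite β] {R : β → (ℕ → Set ℕ) → (α → ℕ) → Prop}
    (hR : ∀ b, ArithDefinable (R b)) : ArithDefinable fun X v => ∀ b, R b X v := by
  choose φ hφ using hR
  refine ⟨Formula.iInf φ, fun X v => ?_⟩
  let _ := natModel X
  exact BoundedFormula.realize_iInf.trans (forall_congr' fun b => hφ b X v)

theorem reindex (σ : α → β) (hR : ArithDefinable R) :
    ArithDefinable fun X (v : β → ℕ) => R X fun i => v (σ i) := by
  obtain ⟨φ, hφ⟩ := hR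
  refine ⟨φ.relabel σ, fun X v => ?_⟩
  let _ := natModel X
  rw [Formula.realize_relabel, hφ]
  rfl

theorem exists_fun [Finite β] {R : (ℕ → Set ℕ) → (α → ℕ) → (β → ℕ) → Prop}
    (hR : ArithDefinable fun X (v : α ⊕ β → ℕ) => R X (fun i => v (.inl i)) fun b => v (.inr b)) :
    ArithDefinable fun X v => ∃ w, R X v w := by
  obtain ⟨φ, hφ⟩ := hR
  refine ⟨φ.iExs β, fun X v => ?_⟩
  let _ := natModel X
  rw [Formula.realize_iExs]
  exact exists_congr fun w => hφ X (Sum.elim v w)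

section Quantifiers

variable {R : (ℕ → Set ℕ) → (α → ℕ) → ℕ → Prop}
  (hR : ArithDefinable fun X (v : α ⊕ Unit → ℕ) => R X (fun i => v (.inl i)) (v (.inr ())))
include hR

theorem ex : ArithDefinable fun X v => ∃ a, R X v a :=
  (exists_fun (R := fun X v w => R X v (w ())) hR).of_iff fun _ _ =>
    ⟨fun ⟨a, ha⟩ => ⟨fun _ => a, ha⟩, fun ⟨w, hw⟩ => ⟨w (), hw⟩⟩

theorem all : ArithDefinable fun X v => ∀ a, R X v a :=
  (ex (R := fun X v a => ¬R X v a) hR.not).not.of_iff fun X v => by simp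

end Quantifiers

theorem subst [Finite β] {R : (ℕ → Set ℕ) → (β → ℕ) → Prop}
    {h : β → (ℕ → Set ℕ) → (α → ℕ) → ℕ} (hR : ArithDefinable R)
    (hh : ∀ b, ArithDefinableFun (h b)) : ArithDefinable fun X v => R X fun b => h b X v := by
  have graph (b : β) : ArithDefinable fun X (v : α ⊕ β → ℕ) =>
      v (.inr b) = h b X fun i => v (.inl i) :=
    (hh b).reindex (Sum.map id fun _ => b)
  refine (exists_fun (R := fun X v w => (∀ b, w b = h b X v) ∧ R X w)
    ((forall_fin graph).and (hR.reindex Sum.inr))).of_iff fun X v => ?_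
  simp only [← funext_iff, exists_eq_left]

theorem subst₁ {R : (ℕ → Set ℕ) → ℕ → Prop} {f : (ℕ → Set ℕ) → (α → ℕ) → ℕ}
    (hR : ArithDefinable fun X (v : Unit → ℕ) => R X (v ())) (hf : ArithDefinableFun f) :
    ArithDefinable fun X v => R X (f X v) :=
  hR.subst fun _ => hf

theorem subst₂ {R : (ℕ → Set ℕ) → ℕ → ℕ → Prop} {f g : (ℕ → Set ℕ) → (α → ℕ) → ℕ}
    (hR : ArithDefinable fun X (v : Fin 2 → ℕ) => R X (v 0) (v 1)) (hf : ArithDefinableFun f)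
    (hg : ArithDefinableFun g) : ArithDefinable fun X v => R X (f X v) (g X v) :=
  hR.subst (h := ![f, g]) <| Fin.forall_fin_two.2 ⟨hf, hg⟩

end ArithDefinable

namespace ArithDefinableFun

variable {α β : Type*} {f g : (ℕ → Set ℕ) → (α → ℕ) → ℕ}

theorem of_term (t : arithLang.Term α) :
    ArithDefinableFun fun X v => @Term.realize arithLang ℕ (natModel X) α v t := by
  refine ⟨(Term.var (.inr ())).equal (t.relabel .inl), fun X v => ?_⟩
  let _ := natModel X
  rw [Formula.realize_equal, Term.realize_relabel]
  rfl

theorem var (i : α) : ArithDefinableFun fun _ v => v i :=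
  of_term (.var i)

theorem zero : ArithDefinableFun fun _ (_ : α → ℕ) => 0 :=
  of_term (.func (ArithFunc.zero : arithLang.Functions 0) ![])

theorem one : ArithDefinableFun fun _ (_ : α → ℕ) => 1 :=
  of_term (.func (ArithFunc.one : arithLang.Functions 0) ![])

theorem comp [Finite β] {k : (ℕ → Set ℕ) → (β → ℕ) → ℕ} {h : β → (ℕ → Set ℕ) → (α → ℕ) → ℕ}
    (hk : ArithDefinableFun k) (hh : ∀ b, ArithDefinableFun (h b)) :
    ArithDefinableFun fun X v => k X fun b => h b X v := by
  have weaken (b : β) : ArithDefinableFun fun X (v : α ⊕ Unit → ℕ) => h b X fun i => v (.inl i) :=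
    (hh b).reindex (Sum.map Sum.inl id)
  exact ArithDefinable.subst (h := Sum.elim (fun b X v => h b X fun i => v (Sum.inl i))
    fun _ _ v => v (Sum.inr ())) hk (Sum.forall.2 ⟨weaken, fun _ => var (Sum.inr ())⟩)

theorem comp₁ {k : (ℕ → Set ℕ) → ℕ → ℕ}
    (hk : ArithDefinableFun fun X (v : Unit → ℕ) => k X (v ())) (hf : ArithDefinableFun f) :
    ArithDefinableFun fun X v => k X (f X v) :=
  hk.comp fun _ => hf

theorem comp₂ {k : (ℕ → Set ℕ) → ℕ → ℕ → ℕ}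
    (hk : ArithDefinableFun fun X (v : Fin 2 → ℕ) => k X (v 0) (v 1)) (hf : ArithDefinableFun f)
    (hg : ArithDefinableFun g) : ArithDefinableFun fun X v => k X (f X v) (g X v) :=
  hk.comp (h := ![f, g]) <| Fin.forall_fin_two.2 ⟨hf, hg⟩

theorem add (hf : ArithDefinableFun f) (hg : ArithDefinableFun g) :
    ArithDefinableFun fun X v => f X v + g X v :=
  comp₂ (k := fun _ a b => a + b)
    (of_term (.func (ArithFunc.add : arithLang.Functions 2) ![.var 0, .var 1])) hf hg

theorem mul (hf : ArithDefinableFun f) (hg : ArithDefinableFun g) :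
    ArithDefinableFun fun X v => f X v * g X v :=
  comp₂ (k := fun _ a b => a * b)
    (of_term (.func (ArithFunc.mul : arithLang.Functions 2) ![.var 0, .var 1])) hf hg

theorem succ (hf : ArithDefinableFun f) : ArithDefinableFun fun X v => f X v + 1 :=
  hf.add one

end ArithDefinableFun

namespace ArithDefinable

variable {α : Type*} {f g : (ℕ → Set ℕ) → (α → ℕ) → ℕ}

theorem eq (hf : ArithDefinableFun f) (hg : ArithDefinableFun g) :
    ArithDefinable fun X v => f X v = g X v := by
  refine subst₂ (R := fun _ a b => a = b) ⟨(Term.var 0).equal (.var 1), fun X v => ?_⟩ hf hg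
  let _ := natModel X
  rw [Formula.realize_equal]
  rfl

theorem mem (k : ℕ) (hf : ArithDefinableFun f) : ArithDefinable fun X v => f X v ∈ X k := by
  refine subst₁ (R := fun X a => a ∈ X k)
    ⟨Relations.formula₁ (ArithRel.set k : arithLang.Relations 1) (.var ()), fun X v => ?_⟩ hf
  let _ := natModel X
  exact Formula.realize_rel₁

theorem lt (hf : ArithDefinableFun f) (hg : ArithDefinableFun g) :
    ArithDefinable fun X v => f X v < g X v := by
  refine subst₂ (R := fun _ a b => a < b) (of_iff (R := fun _ v => ∃ c, v 0 + c + 1 = v 1)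
    (ex (eq ((ArithDefinableFun.var _).add (.var _)).succ (.var _))) fun _ v => ?_) hf hg
  exact ⟨fun h => ⟨v 1 - v 0 - 1, by omega⟩, fun ⟨c, hc⟩ => by omega⟩

end ArithDefinable

namespace ArithDefinableFun

variable {α : Type*} {f g : (ℕ → Set ℕ) → (α → ℕ) → ℕ}

theorem of_graph {h : (ℕ → Set ℕ) → (α → ℕ) → ℕ} {G : (ℕ → Set ℕ) → (α → ℕ) → ℕ → Prop}
    (hG : ArithDefinable fun X (v : α ⊕ Unit → ℕ) => G X (fun i => v (.inl i)) (v (.inr ())))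
    (h_iff : ∀ X v a, a = h X v ↔ G X v a) : ArithDefinableFun h :=
  ArithDefinable.of_iff hG fun X _ => h_iff X _ _

theorem pair (hf : ArithDefinableFun f) (hg : ArithDefinableFun g) :
    ArithDefinableFun fun X v => Nat.pair (f X v) (g X v) := by
  have lt : ArithDefinable fun _ (v : Fin 2 ⊕ Unit → ℕ) => v (.inl 0) < v (.inl 1) :=
    .lt (var _) (var _)
  refine comp₂ (k := fun _ a b => Nat.pair a b) (of_graph (G := fun _ v c =>
    (v 0 < v 1 ∧ c = v 1 * v 1 + v 0) ∨ (¬v 0 < v 1 ∧ c = v 0 * v 0 + v 0 + v 1))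
    ?_ fun _ v c => ?_) hf hg
  · exact (lt.and (.eq (var _) (((var _).mul (var _)).add (var _)))).or
      (lt.not.and (.eq (var _) ((((var _).mul (var _)).add (var _)).add (var _))))
  · simp only [Nat.pair]
    split_ifs with h <;> simp [h]

theorem unpair_fst (hf : ArithDefinableFun f) : ArithDefinableFun fun X v => (f X v).unpair.1 := by
  refine comp₁ (k := fun _ a => a.unpair.1) (of_graph (G := fun _ v a => ∃ b, v () = Nat.pair a b)
    (.ex (.eq (var _) (pair (var _) (var _)))) fun _ v a => ⟨fun h => ?_, ?_⟩) hf
  · exact ⟨(v ()).unpair.2, by rw [h, Nat.pair_unpair]⟩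
  · rintro ⟨b, hb⟩
    rw [hb, Nat.unpair_pair]

theorem unpair_snd (hf : ArithDefinableFun f) : ArithDefinableFun fun X v => (f X v).unpair.2 := by
  refine comp₁ (k := fun _ a => a.unpair.2) (of_graph (G := fun _ v b => ∃ a, v () = Nat.pair a b)
    (.ex (.eq (var _) (pair (var _) (var _)))) fun _ v b => ⟨fun h => ?_, ?_⟩) hf
  · exact ⟨(v ()).unpair.1, by rw [h, Nat.pair_unpair]⟩
  · rintro ⟨a, ha⟩
    rw [ha, Nat.unpair_pair]

theorem mod_succ (hf : ArithDefinableFun f) (hg : ArithDefinableFun g) :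
    ArithDefinableFun fun X v => f X v % (g X v + 1) := by
  refine comp₂ (k := fun _ a b => a % (b + 1)) (of_graph
    (G := fun _ v c => c < v 1 + 1 ∧ ∃ q, v 0 = (v 1 + 1) * q + c)
    (.and (.lt (var _) (var _).succ)
      (.ex (.eq (var _) (((var _).succ.mul (var _)).add (var _))))) fun _ v c => ?_) hf hg
  rw [eq_comm, Nat.mod_eq_iff]
  simp

theorem beta (hf : ArithDefinableFun f) (hg : ArithDefinableFun g) :
    ArithDefinableFun fun X v => Nat.beta (f X v) (g X v) :=
  hf.unpair_fst.mod_succ (hg.succ.mul hf.unpair_snd)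

end ArithDefinableFun

theorem exists_beta_eq (f : ℕ → ℕ) (n : ℕ) : ∃ s, ∀ i ≤ n, Nat.beta s i = f i := by
  refine ⟨Nat.unbeta (List.ofFn fun i : Fin (n + 1) => f i), fun i hi => ?_⟩
  have := Nat.beta_unbeta_coe (List.ofFn fun i : Fin (n + 1) => f i)
    ⟨i, by simpa using Nat.lt_succ_of_le hi⟩
  simpa [-List.ofFn_succ] using this

theorem eq_rec_iff_exists_beta {a : ℕ} {g : ℕ → ℕ → ℕ} {n m : ℕ} :
    m = Nat.rec a g n ↔ ∃ s, Nat.beta s 0 = a ∧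
      (∀ y, y < n → Nat.beta s (y + 1) = g y (Nat.beta s y)) ∧ m = Nat.beta s n := by
  constructor
  · rintro rfl
    obtain ⟨s, hs⟩ := exists_beta_eq (Nat.rec a g) n
    exact ⟨s, hs 0 n.zero_le, fun y hy => by rw [hs _ hy, hs _ hy.le], (hs n le_rfl).symm⟩
  · rintro ⟨s, h0, hs, rfl⟩
    suffices ∀ y ≤ n, Nat.beta s y = Nat.rec a g y from this n le_rfl
    intro y hy
    induction y with
    | zero => exact h0
    | succ y ih => rw [hs y hy, ih (Nat.le_of_succ_le hy)]

theorem ArithDefinableFun.natPrimrec {g : ℕ → ℕ} (hg : Nat.Primrec g) {α : Type*}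
    {f : (ℕ → Set ℕ) → (α → ℕ) → ℕ} (hf : ArithDefinableFun f) :
    ArithDefinableFun fun X v => g (f X v) := by
  suffices h : ArithDefinableFun fun _ (v : Unit → ℕ) => g (v ()) from
    comp₁ (k := fun _ a => g a) h hf
  clear hf
  induction hg with
  | zero => exact zero
  | succ => exact (var _).succ
  | left => exact (var _).unpair_fst
  | right => exact (var _).unpair_snd
  | pair _ _ ihf ihg => exact ihf.pair ihg
  | @comp f g _ _ ihf ihg => exact comp₁ (k := fun _ a => f a) ihf ihg
  | @prec a g _ _ iha ihg =>
    refine of_graph (.ex (.and (.eq ((var _).beta zero) (comp₁ (k := fun _ b => a b) iha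
      (var _).unpair_fst)) (.and (.all (.imp (.lt (var _) (var _).unpair_snd)
        (.eq ((var _).beta (var _).succ) (comp₁ (k := fun _ b => g b) ihg
          ((var _).unpair_fst.pair ((var _).pair ((var _).beta (var _))))))))
      (.eq (var _) ((var _).beta (var _).unpair_snd))))) fun _ _ _ => eq_rec_iff_exists_beta

end Definability
section Arithmetical

open Encodable

/-- The function whose graph is coded by the set `A`; it is total, with value `0` where the graph
has no value. -/
noncomputable def functionOf (A : Set ℕ) (x : ℕ) : ℕ := sInf {y | Nat.pair x y ∈ A}

theorem functionOf_surjective : Function.Surjective functionOf := fun F =>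
  ⟨{z | F z.unpair.1 = z.unpair.2}, funext fun x => by simp [functionOf]⟩

theorem nat_eq_sInf_iff {A : Set ℕ} {y : ℕ} :
    y = sInf A ↔ (y ∈ A ∧ ∀ z, z < y → z ∉ A) ∨ (y = 0 ∧ ∀ z, z ∉ A) := by
  rcases A.eq_empty_or_nonempty with rfl | hA
  · simp
  constructor
  · rintro rfl
    exact .inl ⟨Nat.sInf_mem hA, fun z => Nat.notMem_of_lt_sInf⟩
  · rintro (⟨hy, hlt⟩ | ⟨-, h⟩)
    · exact (not_lt.1 fun hlt' => hlt _ hlt' (Nat.sInf_mem hA)).antisymm (Nat.sInf_le hy)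
    · exact absurd hA.some_mem (h _)

theorem ArithDefinableFun.functionOf_apply {α : Type*} {f : (ℕ → Set ℕ) → (α → ℕ) → ℕ} (k : ℕ)
    (hf : ArithDefinableFun f) : ArithDefinableFun fun X v => functionOf (X k) (f X v) := by
  have graph : ArithDefinable fun X (v : (Unit ⊕ Unit) ⊕ Unit → ℕ) =>
      Nat.pair (v (.inl (.inl ()))) (v (.inr ())) ∈ X k := .mem k ((var _).pair (var _))
  refine comp₁ (k := fun X x => functionOf (X k) x) (of_graph (G := fun X v y =>
    (Nat.pair (v ()) y ∈ X k ∧ ∀ z, z < y → Nat.pair (v ()) z ∉ X k) ∨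
      (y = 0 ∧ ∀ z, Nat.pair (v ()) z ∉ X k))
    (((ArithDefinable.mem k ((var _).pair (var _))).and
      (.all ((ArithDefinable.lt (var _) (var _)).imp graph.not))).or
      ((ArithDefinable.eq (var _) zero).and (.all graph.not))) fun _ _ _ => nat_eq_sInf_iff) hf

/-- A relation between a function `F : ℕ → ℕ` and an element of a coded type that is arithmetical
in `F`. -/
def Arithmetical {α : Type*} [Primcodable α] (R : (ℕ → ℕ) → α → Prop) : Prop :=
  ∃ S : (ℕ → Set ℕ) → ℕ → Prop, ArithDefinable (fun X (v : Unit → ℕ) => S X (v ())) ∧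
    ∀ X a, S X (encode a) ↔ R (functionOf (X 0)) a

/-- A map between coded types that depends on a function `F : ℕ → ℕ` and is arithmetical in `F`. -/
def ArithmeticalFun {α β : Type*} [Primcodable α] [Primcodable β] (h : (ℕ → ℕ) → α → β) : Prop :=
  ∃ k : (ℕ → Set ℕ) → ℕ → ℕ, ArithDefinableFun (fun X (v : Unit → ℕ) => k X (v ())) ∧
    ∀ X a, k X (encode a) = encode (h (functionOf (X 0)) a)

namespace ArithmeticalFun

variable {α β γ : Type*} [Primcodable α] [Primcodable β] [Primcodable γ]
  {h : (ℕ → ℕ) → α → β} {k : (ℕ → ℕ) → α → γ}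

theorem of_primrec {g : α → β} (hg : Primrec g) : ArithmeticalFun fun _ a => g a :=
  ⟨fun _ n => (encode ((decode (α := α) n).map g)).pred,
    (ArithDefinableFun.var ()).natPrimrec (Nat.Primrec.pred.comp hg), fun _ a => by simp⟩

theorem comp {k : (ℕ → ℕ) → β → γ} (hk : ArithmeticalFun k) (hh : ArithmeticalFun h) :
    ArithmeticalFun fun F a => k F (h F a) := by
  obtain ⟨k', hk', hk⟩ := hk
  obtain ⟨h', hh', hh⟩ := hh
  exact ⟨fun X n => k' X (h' X n), hk'.comp₁ hh', fun X a => by simp only [hh, hk]⟩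

theorem pair (hh : ArithmeticalFun h) (hk : ArithmeticalFun k) :
    ArithmeticalFun fun F a => (h F a, k F a) := by
  obtain ⟨h', hh', hh⟩ := hh
  obtain ⟨k', hk', hk⟩ := hk
  exact ⟨fun X n => Nat.pair (h' X n) (k' X n), hh'.pair hk', fun X a => by
    simp only [hh, hk, encode_prod_val]⟩

theorem apply : ArithmeticalFun fun F (x : ℕ) => F x :=
  ⟨fun X n => functionOf (X 0) n, (ArithDefinableFun.var ()).functionOf_apply 0, fun _ _ => rfl⟩

end ArithmeticalFun

namespace Arithmetical

variable {α β : Type*} [Primcodable α] [Primcodable β] {R S : (ℕ → ℕ) → α → Prop}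

theorem of_iff (hR : Arithmetical R) (h : ∀ F a, S F a ↔ R F a) : Arithmetical S :=
  let ⟨T, hT, hRT⟩ := hR
  ⟨T, hT, fun X a => (hRT X a).trans (h _ a).symm⟩

theorem not (hR : Arithmetical R) : Arithmetical fun F a => ¬R F a := by
  obtain ⟨T, hT, h⟩ := hR
  exact ⟨fun X n => ¬T X n, hT.not, fun X a => not_congr (h X a)⟩

theorem and (hR : Arithmetical R) (hS : Arithmetical S) :
    Arithmetical fun F a => R F a ∧ S F a := by
  obtain ⟨T, hT, hRT⟩ := hR
  obtain ⟨U, hU, hSU⟩ := hS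
  exact ⟨fun X n => T X n ∧ U X n, hT.and hU, fun X a => and_congr (hRT X a) (hSU X a)⟩

theorem or (hR : Arithmetical R) (hS : Arithmetical S) : Arithmetical fun F a => R F a ∨ S F a :=
  (hR.not.and hS.not).not.of_iff fun F a => by tauto

theorem imp (hR : Arithmetical R) (hS : Arithmetical S) : Arithmetical fun F a => R F a → S F a :=
  (hR.and hS.not).not.of_iff fun F a => by tauto

theorem comp {R : (ℕ → ℕ) → β → Prop} {h : (ℕ → ℕ) → α → β} (hR : Arithmetical R)
    (hh : ArithmeticalFun h) : Arithmetical fun F a => R F (h F a) := by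
  obtain ⟨T, hT, hRT⟩ := hR
  obtain ⟨k, hk, hhk⟩ := hh
  exact ⟨fun X n => T X (k X n), hT.subst₁ hk, fun X a => by simp only [hhk, hRT]⟩

theorem of_primrecPred {p : β → Prop} {h : (ℕ → ℕ) → α → β} (hp : PrimrecPred p)
    (hh : ArithmeticalFun h) : Arithmetical fun F a => p (h F a) := by
  classical
  obtain ⟨k, hk, hhk⟩ := (ArithmeticalFun.of_primrec hp.decide).comp hh
  refine ⟨fun X n => k X n = 1, .eq hk .one, fun X a => ?_⟩
  by_cases hp : p (h (functionOf (X 0)) a) <;> simp [hhk, hp]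

theorem eq {h k : (ℕ → ℕ) → α → β} (hh : ArithmeticalFun h) (hk : ArithmeticalFun k) :
    Arithmetical fun F a => h F a = k F a :=
  of_primrecPred (p := fun q : β × β => q.1 = q.2) Primrec.eq (hh.pair hk)

theorem le {h k : (ℕ → ℕ) → α → ℕ} (hh : ArithmeticalFun h) (hk : ArithmeticalFun k) :
    Arithmetical fun F a => h F a ≤ k F a :=
  of_primrecPred (p := fun q : ℕ × ℕ => q.1 ≤ q.2) Primrec.nat_le (hh.pair hk)

theorem ex {R : (ℕ → ℕ) → α → β → Prop} (hR : Arithmetical fun F (p : α × β) => R F p.1 p.2) :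
    Arithmetical fun F a => ∃ b, R F a b := by
  obtain ⟨T, hT, hRT⟩ := hR
  have code : ArithDefinableFun fun _ (v : Unit ⊕ Unit → ℕ) =>
      encode (decode (α := β) (v (.inr ()))) := (ArithDefinableFun.var _).natPrimrec
        (Primcodable.prim β)
  refine ⟨fun X n => ∃ y, ¬encode (decode (α := β) y) = 0 ∧
    T X (Nat.pair n (encode (decode (α := β) y)).pred), .ex ((ArithDefinable.eq code .zero).not.and
      (hT.subst₁ ((ArithDefinableFun.var _).pair (code.natPrimrec Nat.Primrec.pred)))),
    fun X a => ⟨?_, fun ⟨b, hb⟩ => ⟨encode b, by simp, ?_⟩⟩⟩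
  · rintro ⟨y, hy, hT⟩
    cases hd : decode (α := β) y with
    | none => simp [hd] at hy
    | some b => exact ⟨b, (hRT X (a, b)).1 (by simpa [hd] using hT)⟩
  · simpa using (hRT X (a, b)).2 hb

theorem all {R : (ℕ → ℕ) → α → β → Prop} (hR : Arithmetical fun F (p : α × β) => R F p.1 p.2) :
    Arithmetical fun F a => ∀ b, R F a b :=
  (ex (R := fun F a b => ¬R F a b) hR.not).not.of_iff fun F a => by simp

theorem isPi11 {R : (ℕ → ℕ) → ℕ → Prop} (hR : Arithmetical R) : IsPi11 {n | ∀ F, R F n} := by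
  obtain ⟨T, ⟨φ, hφ⟩, hRT⟩ := hR
  refine ⟨φ, fun n => ?_⟩
  simp only [hφ, Set.mem_ofPred_eq]
  exact ⟨fun h X => (hRT X n).2 (h _), fun h F =>
    let ⟨A, hA⟩ := functionOf_surjective F
    hA ▸ (hRT (fun _ => A) n).1 (h _)⟩

end Arithmetical

end Arithmetical

section Membership

open Encodable Filter

/-- Whether a move goes to the right, as recorded in the code of a transition. -/
def Dir.isRight : Dir → Bool
  | left => false
  | right => true

namespace NDTM

/-- An infinite computation `c` of `M` that visits the state `qr` infinitely often. -/
def Recurs (M : NDTM) (qr : M.State) (c : ℕ → M.Config) : Prop :=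
  (∀ i, c (i + 1) ∈ M.Next (c i)) ∧ ∃ᶠ i in atTop, (c i).q = qr

theorem IsRun.eq_none_of_le {M : NDTM} {ρ : M.Config} {S : ℕ → Option M.Config}
    (hS : M.IsRun ρ S) {i j : ℕ} (hij : i ≤ j) (hi : S i = none) : S j = none := by
  induction j, hij using Nat.le_induction with
  | base => exact hi
  | succ j _ ih => exact hS.2.1 j ih

theorem IsRun.exists_recurs {M : NDTM} {qr : M.State} {ρ : M.Config} {S : ℕ → Option M.Config}
    (hS : M.IsRun ρ S) (hq : ∃ᶠ i in atTop, ∃ ρ', S i = some ρ' ∧ ρ'.q = qr) :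
    ∃ c, c 0 = ρ ∧ M.Recurs qr c := by
  have total : ∀ i, ∃ ρ', S i = some ρ' := fun i => by
    obtain ⟨j, hij, ρ', hρ', -⟩ := frequently_atTop.1 hq i
    exact Option.ne_none_iff_exists'.1 fun hi => by simp [hS.eq_none_of_le hij hi] at hρ'
  choose c hc using total
  refine ⟨c, Option.some_injective _ ((hc 0).symm.trans hS.1), fun i => ?_, ?_⟩
  · obtain ⟨ρ', hρ', h⟩ | ⟨-, h⟩ := hS.2.2 i _ (hc i)
    · rwa [← Option.some_injective _ (h.symm.trans (hc (i + 1)))]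
    · simp [hc] at h
  · simpa [hc] using hq

theorem nonRecurringFrom_iff {M : NDTM} {qr : M.State} {ρ : M.Config} :
    M.NonRecurringFrom qr ρ ↔ ¬∃ c, c 0 = ρ ∧ M.Recurs qr c := by
  constructor
  · rintro h ⟨c, rfl, hc, hq⟩
    have run : M.IsRun (c 0) fun i => some (c i) :=
      ⟨rfl, fun i hi => by simp at hi, fun i ρ hi => .inl ⟨c (i + 1), by cases hi; exact hc i, rfl⟩⟩
    exact Nat.frequently_atTop_iff_infinite.1 hq (by simpa using h _ run)
  · intro h S hS
    by_contra infinite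
    exact h (hS.exists_recurs (Nat.frequently_atTop_iff_infinite.2 infinite))

/-- A transition `⟨r, a, d⟩ ∈ δ(s, q)` as the tuple `(q, s, r, a, d)` of numbers. -/
abbrev Transition : Type := ℕ × Option ℕ × ℕ × ℕ × Bool

namespace Transition

/-- The state in which a transition can be taken. -/
@[simp] abbrev source (y : Transition) : ℕ := y.1

/-- The symbol that a transition reads. -/
@[simp] abbrev read (y : Transition) : Option ℕ := y.2.1

/-- The state to which a transition leads. -/
@[simp] abbrev target (y : Transition) : ℕ := y.2.2.1

/-- The symbol that a transition writes. -/
@[simp] abbrev write (y : Transition) : ℕ := y.2.2.2.1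

/-- Whether a transition moves the head to the right. -/
@[simp] abbrev goesRight (y : Transition) : Bool := y.2.2.2.2

theorem primrec_source : Primrec source := .fst

theorem primrec_read : Primrec read := Primrec.fst.comp .snd

theorem primrec_target : Primrec target :=
  Primrec.fst.comp (Primrec.snd.comp .snd)

theorem primrec_write : Primrec write :=
  Primrec.fst.comp (Primrec.snd.comp (Primrec.snd.comp .snd))

theorem primrec_goesRight : Primrec goesRight :=
  Primrec.snd.comp (Primrec.snd.comp (Primrec.snd.comp .snd))

/-- The entries of a transition denote states and symbols of a machine with states `0, …, k` and
symbols `0, …, m + 1`. -/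
def Bounded (k m : ℕ) (y : Transition) : Prop :=
  y.source < k + 1 ∧ encode y.read < m + 3 ∧ y.target < k + 1 ∧ y.write < m + 2

theorem primrecRel_bounded :
    PrimrecRel fun (y : Transition) (p : ℕ × ℕ) => Bounded p.1 p.2 y := by
  have states : Primrec fun a : Transition × ℕ × ℕ => a.2.1 + 1 := .comp .succ (.comp .fst .snd)
  have symbols : Primrec fun a : Transition × ℕ × ℕ => a.2.2 + 2 :=
    .comp .succ (.comp .succ (.comp .snd .snd))
  exact (Primrec.nat_lt.comp (primrec_source.comp .fst) states).and <|
    (Primrec.nat_lt.comp (.comp .encode (primrec_read.comp .fst)) (.comp .succ symbols)).and <|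
    (Primrec.nat_lt.comp (primrec_target.comp .fst) states).and <|
    Primrec.nat_lt.comp (primrec_write.comp .fst) symbols

end Transition

/-- A tuple `(k, m, qr, l)`, the code of which is the code of a machine with the list `l` of
transitions, together with its state `qr`. -/
abbrev Description : Type := ℕ × ℕ × ℕ × List Transition

namespace Description

/-- The largest state of the described machine. -/
abbrev k (x : Description) : ℕ := x.1

/-- The number of symbols besides `0` and `1`. -/
abbrev m (x : Description) : ℕ := x.2.1

/-- The distinguished state. -/
abbrev state (x : Description) : ℕ := x.2.2.1

/-- The list of all transitions. -/
abbrev transitions (x : Description) : List Transition := x.2.2.2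

theorem primrec_k : Primrec k := .fst

theorem primrec_m : Primrec m := Primrec.fst.comp .snd

theorem primrec_state : Primrec state := Primrec.fst.comp (Primrec.snd.comp .snd)

theorem primrec_transitions : Primrec transitions := Primrec.snd.comp (Primrec.snd.comp .snd)

/-- All numbers in the description denote states and symbols. -/
def Valid (x : Description) : Prop :=
  x.state < x.k + 1 ∧ ∀ y ∈ x.transitions, y.Bounded x.k x.m

theorem primrecPred_valid : PrimrecPred Valid :=
  (Primrec.nat_lt.comp primrec_state (Primrec.succ.comp primrec_k)).and
    (Transition.primrecRel_bounded.forall_mem_list.comp primrec_transitions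
      (primrec_k.pair primrec_m))

end Description

/-- The machine with a given description; transitions that are out of bounds are ignored. -/
def ofDescription (x : Description) : NDTM where
  k := x.k
  m := x.m
  δ := fun s q => {y | (q.val, s.map Fin.val, y.1.val, y.2.1.val, y.2.2.isRight) ∈ x.transitions}

theorem transitionCode_mk (M : NDTM) (q : M.State) (s : Option M.Symbol) (r : M.State)
    (a : M.Symbol) (d : Dir) :
    M.transitionCode (q, s, r, a, d) = (q.val, s.map Fin.val, r.val, a.val, d.isRight) := by
  cases d <;> rfl

theorem mem_δ_ofDescription {x : Description} {s q r a d} :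
    (r, a, d) ∈ (ofDescription x).δ s q ↔
      (ofDescription x).transitionCode (q, s, r, a, d) ∈ x.transitions := by
  rw [transitionCode_mk]; rfl

theorem transitionCode_injective (M : NDTM) : Function.Injective M.transitionCode := by
  rintro ⟨q, s, r, a, d⟩ ⟨q', s', r', a', d'⟩ h
  simp only [transitionCode_mk, Prod.mk.injEq, Fin.val_inj] at h
  obtain ⟨rfl, hs, rfl, rfl, hd⟩ := h
  obtain rfl := Option.map_injective Fin.val_injective hs
  cases d <;> cases d' <;> simp_all [Dir.isRight]

theorem bounded_transitionCode (M : NDTM) (z) :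
    Transition.Bounded M.k M.m (M.transitionCode z) := by
  obtain ⟨q, s, r, a, d⟩ := z
  refine ⟨q.2, ?_, r.2, a.2⟩
  rw [transitionCode_mk]
  cases s with
  | none => simp
  | some s => have := s.2; simp

theorem exists_transitionCode_eq (M : NDTM) {y : Transition} (hy : y.Bounded M.k M.m) :
    ∃ z, M.transitionCode z = y := by
  obtain ⟨q, s, r, a, d⟩ := y
  obtain ⟨hq, hs, hr, ha⟩ := hy
  obtain ⟨s', rfl⟩ : ∃ s' : Option M.Symbol, s'.map Fin.val = s := by
    cases s with
    | none => exact ⟨none, rfl⟩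
    | some s => exact ⟨some ⟨s, by simp at hs; omega⟩, rfl⟩
  exact ⟨(⟨q, hq⟩, s', ⟨r, hr⟩, ⟨a, ha⟩, if d then Dir.right else Dir.left),
    by cases d <;> simp [transitionCode]⟩

theorem exists_map_transitionCode_eq (M : NDTM) {l : List Transition}
    (hl : ∀ y ∈ l, y.Bounded M.k M.m) : ∃ l' : List _, l'.map M.transitionCode = l := by
  choose f hf using fun y : {y : Transition // y.Bounded M.k M.m} =>
    M.exists_transitionCode_eq y.2
  exact ⟨l.attach.map fun y => f ⟨y.1, hl y.1 y.2⟩, by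
    simpa [Function.comp_def, hf] using List.attach_map_subtype_val l⟩

theorem isCode_ofDescription {x : Description} (hx : x.Valid) :
    IsCode (encode x) (ofDescription x) ⟨x.state, hx.1⟩ := by
  obtain ⟨l, hl⟩ := (ofDescription x).exists_map_transitionCode_eq hx.2
  refine ⟨l, fun q s r a d => ?_, by rw [hl]; rfl⟩
  rw [← List.mem_map_of_injective (transitionCode_injective _), hl, mem_δ_ofDescription]

theorem δ_ofDescription_map_transitionCode {M : NDTM}
    {l : List (M.State × Option M.Symbol × M.State × M.Symbol × Dir)}
    (hl : ∀ q s r a d, (q, s, r, a, d) ∈ l ↔ (r, a, d) ∈ M.δ s q) (qr : ℕ) :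
    (ofDescription (M.k, M.m, qr, l.map M.transitionCode)).δ = M.δ := by
  funext s q
  ext ⟨r, a, d⟩
  exact mem_δ_ofDescription.trans
    ((List.mem_map_of_injective (a := (q, s, r, a, d)) M.transitionCode_injective).trans (hl ..))

theorem mem_codesOf {P : (M : NDTM) → M.State → Prop} {c : ℕ} :
    c ∈ codesOf P ↔ ∃ x : Description, encode x = c ∧ ∃ h : x.Valid,
      P (ofDescription x) ⟨x.state, h.1⟩ := by
  constructor
  · rintro ⟨M, qr, ⟨l, hl, rfl⟩, hP⟩
    refine ⟨_, rfl, ⟨qr.2, ?_⟩, ?_⟩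
    · intro y hy
      obtain ⟨z, -, rfl⟩ := List.mem_map.1 hy
      exact M.bounded_transitionCode z
    · change P ⟨M.k, M.m, (ofDescription (M.k, M.m, qr.val, l.map M.transitionCode)).δ⟩ qr
      rwa [δ_ofDescription_map_transitionCode hl]
  · rintro ⟨x, rfl, hx, hP⟩
    exact ⟨_, _, isCode_ofDescription hx, hP⟩

/-! ### Computations coded by functions on the natural numbers -/

/-- The number `n` of the `i`-th configuration of the computation coded by `F`. -/
def lengthAt (F : ℕ → ℕ) (i : ℕ) : ℕ := F (Nat.pair 0 i)

/-- The head position of the `i`-th configuration of the computation coded by `F`. -/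
def headAt (F : ℕ → ℕ) (i : ℕ) : ℕ := F (Nat.pair 1 i)

/-- The state of the `i`-th configuration of the computation coded by `F`. -/
def stateAt (F : ℕ → ℕ) (i : ℕ) : ℕ := F (Nat.pair 2 i)

/-- The tape of the `i`-th configuration of the computation coded by `F`. -/
def tapeAt (F : ℕ → ℕ) (i j : ℕ) : ℕ := F (Nat.pair 3 (Nat.pair i j))

/-- The number of a tape symbol, which is `0` for the blank and `s + 1` for the symbol `s`. -/
def cell {m : ℕ} (s : Option (Fin m)) : ℕ := encode (s.map Fin.val)

theorem cell_injective {m : ℕ} : Function.Injective (cell (m := m)) :=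
  encode_injective.comp (Option.map_injective Fin.val_injective)

theorem cell_eq_zero {m : ℕ} {s : Option (Fin m)} : cell s = 0 ↔ s = none := by
  cases s <;> simp [cell]

theorem cell_le {m : ℕ} (s : Option (Fin m)) : cell s ≤ m := by
  cases s <;> simp [cell]

theorem exists_cell_eq {m c : ℕ} (hc : c ≤ m) : ∃ s : Option (Fin m), cell s = c := by
  cases c with
  | zero => exact ⟨none, rfl⟩
  | succ c => exact ⟨some ⟨c, hc⟩, by simp [cell]⟩

/-- The `i`-th configuration coded by `F` is `ρ`. -/
structure Describes {M : NDTM} (F : ℕ → ℕ) (i : ℕ) (ρ : M.Config) : Prop where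
  length : lengthAt F i = ρ.n
  head : headAt F i = ρ.p
  state : stateAt F i = ρ.q.val
  tape : ∀ j, tapeAt F i j = cell (ρ.t j)

theorem exists_describes {M : NDTM} (c : ℕ → M.Config) : ∃ F, ∀ i, Describes F i (c i) := by
  refine ⟨fun y => match y.unpair with
    | (0, i) => (c i).n
    | (1, i) => (c i).p
    | (2, i) => (c i).q.val
    | (_, z) => cell ((c z.unpair.1).t z.unpair.2), fun i => ⟨?_, ?_, ?_, fun j => ?_⟩⟩ <;>
  simp [lengthAt, headAt, stateAt, tapeAt]

/-- The numbers that `F` codes at time `i` are those of a configuration of a machine with states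
`0, …, k` and symbols `0, …, m + 1`. -/
def ConfigAt (F : ℕ → ℕ) (k m i : ℕ) : Prop :=
  stateAt F i ≤ k ∧ (∀ j, tapeAt F i j ≤ m + 2) ∧
  (∀ j, j = 0 ∨ lengthAt F i + 1 ≤ j → tapeAt F i j = 0) ∧ tapeAt F i (lengthAt F i) = 0 ∧
  (∀ j, 1 ≤ j → j + 1 ≤ lengthAt F i → tapeAt F i j = 0 → tapeAt F i (j + 1) = 0) ∧
  1 ≤ headAt F i ∧ headAt F i ≤ lengthAt F i

theorem Describes.configAt {M : NDTM} {F : ℕ → ℕ} {i : ℕ} {ρ : M.Config} (h : Describes F i ρ) :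
    ConfigAt F M.k M.m i := by
  simp only [ConfigAt, h.length, h.head, h.state, h.tape, cell_eq_zero]
  exact ⟨Nat.le_of_lt_succ ρ.q.2, fun j => cell_le _, ρ.outside, ρ.last_blank, ρ.blank_succ,
    ρ.one_le_p, ρ.p_le_n⟩

theorem ConfigAt.exists_describes {M : NDTM} {F : ℕ → ℕ} {i : ℕ} (h : ConfigAt F M.k M.m i) :
    ∃ ρ : M.Config, Describes F i ρ := by
  obtain ⟨state_le, tape_le, outside, last_blank, blank_succ, one_le_p, p_le_n⟩ := h
  choose t ht using fun j => exists_cell_eq (tape_le j)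
  simp only [← ht, cell_eq_zero] at outside last_blank blank_succ
  exact ⟨⟨lengthAt F i, t, headAt F i, ⟨stateAt F i, Nat.lt_succ_of_le state_le⟩, outside,
    last_blank, blank_succ, one_le_p, p_le_n⟩, rfl, rfl, rfl, fun j => (ht j).symm⟩

/-- The numbers that `F` codes at the times `i` and `i + 1` are related by the transition `y`. -/
def TransitionAt (F : ℕ → ℕ) (y : Transition) (i : ℕ) : Prop :=
  stateAt F i = y.source ∧ tapeAt F i (headAt F i) = encode y.read ∧
  (y.goesRight = true ∨ 2 ≤ headAt F i) ∧
  lengthAt F (i + 1) = lengthAt F i + 1 ∧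
  tapeAt F (i + 1) (headAt F i) = y.write + 1 ∧
  (∀ j, j ≠ headAt F i → tapeAt F (i + 1) j = tapeAt F i j) ∧
  headAt F (i + 1) = (bif y.goesRight then headAt F i + 1 else headAt F i - 1) ∧
  stateAt F (i + 1) = y.target

theorem transitionAt_transitionCode_iff {M : NDTM} {F : ℕ → ℕ} {i : ℕ} {ρ ρ' : M.Config}
    (h : Describes F i ρ) (h' : Describes F (i + 1) ρ') {q s r a d} :
    TransitionAt F (M.transitionCode (q, s, r, a, d)) i ↔
      ρ.q = q ∧ ρ.t ρ.p = s ∧ (d = .right ∨ 2 ≤ ρ.p) ∧ ρ'.n = ρ.n + 1 ∧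
      ρ'.t = Function.update ρ.t ρ.p (some a) ∧
      ρ'.p = (match d with
        | .left => ρ.p - 1
        | .right => ρ.p + 1) ∧
      ρ'.q = r := by
  have write : ∀ s : Option M.Symbol, cell s = a.val + 1 ↔ s = some a := fun s =>
    cell_injective.eq_iff (b := some a)
  have read : ∀ s' : Option M.Symbol, cell s' = encode (s.map Fin.val) ↔ s' = s := fun s' =>
    cell_injective.eq_iff
  simp only [TransitionAt, transitionCode_mk, h.state, h.head, h.tape, h.length, h'.state, h'.head,
    h'.tape, h'.length, Function.eq_update_iff, write, read, cell_injective.eq_iff,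
    and_assoc]
  cases d <;> simp [Dir.isRight, Fin.val_inj]

/-- The numbers that `F` codes at the times `i` and `i + 1` are related by a transition in `l`. -/
def StepAt (F : ℕ → ℕ) (l : List Transition) (i : ℕ) : Prop := ∃ y ∈ l, TransitionAt F y i

theorem stepAt_iff {x : Description} (hx : x.Valid) {F : ℕ → ℕ} {i : ℕ}
    {ρ ρ' : (ofDescription x).Config} (h : Describes F i ρ) (h' : Describes F (i + 1) ρ') :
    StepAt F x.transitions i ↔ ρ' ∈ (ofDescription x).Next ρ := by
  constructor
  · rintro ⟨y, hy, hyF⟩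
    obtain ⟨⟨q, s, r, a, d⟩, rfl⟩ := (ofDescription x).exists_transitionCode_eq (hx.2 y hy)
    obtain ⟨rfl, rfl, hstep⟩ := (transitionAt_transitionCode_iff h h').1 hyF
    exact ⟨r, a, d, mem_δ_ofDescription.2 hy, hstep⟩
  · rintro ⟨r, a, d, hδ, hstep⟩
    exact ⟨_, mem_δ_ofDescription.1 hδ,
      (transitionAt_transitionCode_iff h h').2 ⟨rfl, rfl, hstep⟩⟩

/-- `F` codes an infinite computation of the machine with description `x` that visits the
distinguished state infinitely often. -/
def RecursBy (F : ℕ → ℕ) (x : Description) : Prop :=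
  (∀ i, ConfigAt F x.k x.m i) ∧ (∀ i, StepAt F x.transitions i) ∧
    ∃ᶠ i in atTop, stateAt F i = x.state

theorem exists_recurs_iff {x : Description} (hx : x.Valid)
    {I : (ofDescription x).Config → Prop} {J : (ℕ → ℕ) → Prop}
    (hIJ : ∀ F ρ, Describes F 0 ρ → (J F ↔ I ρ)) :
    (∃ c, I (c 0) ∧ (ofDescription x).Recurs ⟨x.state, hx.1⟩ c) ↔ ∃ F, J F ∧ RecursBy F x := by
  constructor
  · rintro ⟨c, hI, hc, hq⟩
    obtain ⟨F, hF⟩ := exists_describes c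
    exact ⟨F, (hIJ F _ (hF 0)).2 hI, fun i => (hF i).configAt,
      fun i => (stepAt_iff hx (hF i) (hF (i + 1))).2 (hc i),
      hq.mono fun i hi => (hF i).state.trans (congrArg Fin.val hi)⟩
  · rintro ⟨F, hJ, hF, hs, hq⟩
    choose c hc using fun i => (hF i).exists_describes (M := ofDescription x)
    exact ⟨c, (hIJ F _ (hc 0)).1 hJ, fun i => (stepAt_iff hx (hc i) (hc (i + 1))).1 (hs i),
      hq.mono fun i hi => Fin.ext ((hc i).state.symm.trans hi)⟩

section Arithmetical

variable {α : Type*} [Primcodable α] {i j : (ℕ → ℕ) → α → ℕ}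

theorem arithmeticalFun_lengthAt (hi : ArithmeticalFun i) :
    ArithmeticalFun fun F a => lengthAt F (i F a) :=
  ArithmeticalFun.apply.comp
    ((ArithmeticalFun.of_primrec (Primrec₂.natPair.comp (.const 0) .id)).comp hi)

theorem arithmeticalFun_headAt (hi : ArithmeticalFun i) :
    ArithmeticalFun fun F a => headAt F (i F a) :=
  ArithmeticalFun.apply.comp
    ((ArithmeticalFun.of_primrec (Primrec₂.natPair.comp (.const 1) .id)).comp hi)

theorem arithmeticalFun_stateAt (hi : ArithmeticalFun i) :
    ArithmeticalFun fun F a => stateAt F (i F a) :=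
  ArithmeticalFun.apply.comp
    ((ArithmeticalFun.of_primrec (Primrec₂.natPair.comp (.const 2) .id)).comp hi)

theorem arithmeticalFun_tapeAt (hi : ArithmeticalFun i) (hj : ArithmeticalFun j) :
    ArithmeticalFun fun F a => tapeAt F (i F a) (j F a) :=
  ArithmeticalFun.apply.comp ((ArithmeticalFun.of_primrec (g := fun p : ℕ × ℕ => Nat.pair 3
    (Nat.pair p.1 p.2)) (Primrec₂.natPair.comp (.const 3) Primrec₂.natPair)).comp (hi.pair hj))

theorem arithmeticalFun_const {β : Type*} [Primcodable β] (b : β) :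
    ArithmeticalFun fun (_ : ℕ → ℕ) (_ : α) => b := .of_primrec (.const b)

theorem arithmeticalFun_succ (hi : ArithmeticalFun i) : ArithmeticalFun fun F a => i F a + 1 :=
  .comp (.of_primrec .succ) hi

theorem arithmetical_configAt :
    Arithmetical fun F (a : Description × ℕ) => ConfigAt F a.1.k a.1.m a.2 := by
  have hi : ArithmeticalFun fun _ (a : Description × ℕ) => a.2 := .of_primrec .snd
  have hi' : ArithmeticalFun fun _ (a : (Description × ℕ) × ℕ) => a.1.2 :=
    .of_primrec (.comp .snd .fst)
  have hj : ArithmeticalFun fun _ (a : (Description × ℕ) × ℕ) => a.2 := .of_primrec .snd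
  have length := arithmeticalFun_lengthAt hi'
  have blank {β : Type} [Primcodable β] {i j : (ℕ → ℕ) → β → ℕ} (hi : ArithmeticalFun i)
      (hj : ArithmeticalFun j) : Arithmetical fun F b => tapeAt F (i F b) (j F b) = 0 :=
    .eq (arithmeticalFun_tapeAt hi hj) (arithmeticalFun_const 0)
  refine .and (.le (arithmeticalFun_stateAt hi) (.of_primrec (Description.primrec_k.comp .fst)))
    (.and (.all (.le (arithmeticalFun_tapeAt hi' hj)
      (arithmeticalFun_succ (arithmeticalFun_succ
        (.of_primrec (Description.primrec_m.comp (.comp .fst .fst)))))))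
    (.and (.all (.imp
      (.or (.eq hj (arithmeticalFun_const 0)) (.le (arithmeticalFun_succ length) hj))
      (blank hi' hj)))
    (.and (blank hi (arithmeticalFun_lengthAt hi))
    (.and (.all (.imp (.le (arithmeticalFun_const 1) hj)
      (.imp (.le (arithmeticalFun_succ hj) length)
        (.imp (blank hi' hj) (blank hi' (arithmeticalFun_succ hj))))))
    (.and (.le (arithmeticalFun_const 1) (arithmeticalFun_headAt hi))
      (.le (arithmeticalFun_headAt hi) (arithmeticalFun_lengthAt hi)))))))

theorem arithmetical_transitionAt :
    Arithmetical fun F (a : Transition × ℕ) => TransitionAt F a.1 a.2 := by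
  have hi : ArithmeticalFun fun _ (a : Transition × ℕ) => a.2 := .of_primrec .snd
  have hi' : ArithmeticalFun fun _ (a : (Transition × ℕ) × ℕ) => a.1.2 :=
    .of_primrec (.comp .snd .fst)
  have hj : ArithmeticalFun fun _ (a : (Transition × ℕ) × ℕ) => a.2 := .of_primrec .snd
  have head := arithmeticalFun_headAt hi
  have right : ArithmeticalFun fun _ (a : Transition × ℕ) => a.1.goesRight :=
    .of_primrec (Transition.primrec_goesRight.comp .fst)
  have move : Primrec fun p : Bool × ℕ => bif p.1 then p.2 + 1 else p.2 - 1 :=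
    .cond .fst (.comp .succ .snd) (.comp .pred .snd)
  refine .and (.eq (arithmeticalFun_stateAt hi)
      (.of_primrec (Transition.primrec_source.comp .fst)))
    (.and (.eq (arithmeticalFun_tapeAt hi head)
      (.of_primrec (Primrec.encode.comp (Transition.primrec_read.comp .fst))))
    (.and (.or (.eq right (arithmeticalFun_const true)) (.le (arithmeticalFun_const 2) head))
    (.and (.eq (arithmeticalFun_lengthAt (arithmeticalFun_succ hi))
      (arithmeticalFun_succ (arithmeticalFun_lengthAt hi)))
    (.and (.eq (arithmeticalFun_tapeAt (arithmeticalFun_succ hi) head)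
      (arithmeticalFun_succ (.of_primrec (Transition.primrec_write.comp .fst))))
    (.and (.all (.imp (.not (.eq hj (arithmeticalFun_headAt hi')))
      (.eq (arithmeticalFun_tapeAt (arithmeticalFun_succ hi') hj) (arithmeticalFun_tapeAt hi' hj))))
    (.and (.eq (arithmeticalFun_headAt (arithmeticalFun_succ hi))
      (.comp (.of_primrec move) (right.pair head)))
    (.eq (arithmeticalFun_stateAt (arithmeticalFun_succ hi))
      (.of_primrec (Transition.primrec_target.comp .fst)))))))))

theorem arithmetical_stepAt :
    Arithmetical fun F (a : Description × ℕ) => StepAt F a.1.transitions a.2 := by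
  have mem : PrimrecPred fun a : (Description × ℕ) × Transition => a.2 ∈ a.1.1.transitions :=
    ((PrimrecRel.exists_mem_list (R := fun a b : Transition => a = b) Primrec.eq).comp
      (Description.primrec_transitions.comp (.comp .fst .fst)) .snd).of_eq fun a => by simp
  exact .ex (.and (.of_primrecPred mem (.of_primrec .id))
    (arithmetical_transitionAt.comp (.of_primrec (.pair .snd (.comp .snd .fst)))))

theorem arithmetical_recursBy : Arithmetical fun F (x : Description) => RecursBy F x := by
  have frequently : Arithmetical fun F (x : Description) =>
      ∃ᶠ i in atTop, stateAt F i = x.state :=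
    .of_iff (R := fun F x => ∀ i, ∃ j ≥ i, stateAt F j = x.state) (.all (.ex (.and
      (.le (.of_primrec (.comp .snd .fst)) (.of_primrec .snd))
      (.eq (arithmeticalFun_stateAt (.of_primrec .snd))
        (.of_primrec (Description.primrec_state.comp (.comp .fst .fst)))))))
      fun F x => frequently_atTop
  exact .and (.all arithmetical_configAt) (.and (.all arithmetical_stepAt) frequently)

end Arithmetical

theorem forall_nonRecurringFrom_iff {M : NDTM} {qr : M.State} {I : M.Config → Prop} :
    (∀ ρ, I ρ → M.NonRecurringFrom qr ρ) ↔ ¬∃ c, I (c 0) ∧ M.Recurs qr c := by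
  simp only [nonRecurringFrom_iff]
  exact ⟨fun h ⟨c, hI, hc⟩ => h _ hI ⟨c, rfl, hc⟩,
    fun h ρ hI ⟨c, hρ, hc⟩ => h ⟨c, hρ ▸ hI, hc⟩⟩

theorem isPi11_codesOf {I : (M : NDTM) → M.Config → Prop} {J : (ℕ → ℕ) → Description → Prop}
    (hJ : Arithmetical J) (hIJ : ∀ F (x : Description), x.Valid → ∀ ρ : (ofDescription x).Config,
      Describes F 0 ρ → (J F x ↔ I _ ρ)) :
    IsPi11 (codesOf fun M qr => ∀ ρ, I M ρ → M.NonRecurringFrom qr ρ) := by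
  have arithmetical : Arithmetical fun F (c : ℕ) => ∃ x : Description, encode x = c ∧ x.Valid ∧
      ¬(J F x ∧ RecursBy F x) :=
    .ex (.and (.eq (.of_primrec (.comp .encode .snd)) (.of_primrec .fst))
      (.and (.of_primrecPred Description.primrecPred_valid (.of_primrec .snd))
        ((hJ.and arithmetical_recursBy).not.comp (.of_primrec .snd))))
  convert arithmetical.isPi11
  ext c
  rw [mem_codesOf, Set.mem_ofPred_eq]
  have nonRecurring : ∀ x : Description, (hx : x.Valid) → ((∀ ρ, I (ofDescription x) ρ →
      (ofDescription x).NonRecurringFrom ⟨x.state, hx.1⟩ ρ) ↔ ∀ F, ¬(J F x ∧ RecursBy F x)) :=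
    fun x hx => by
      rw [forall_nonRecurringFrom_iff, exists_recurs_iff hx (hIJ · x hx), not_exists]
  constructor
  · rintro ⟨x, hc, hx, h⟩ F
    exact ⟨x, hc, hx, (nonRecurring x hx).1 h F⟩
  · intro h
    obtain ⟨x, rfl, hx, -⟩ := h 0
    refine ⟨x, rfl, hx, (nonRecurring x hx).2 fun F => ?_⟩
    obtain ⟨x', hx', -, hF⟩ := h F
    rwa [encode_injective hx'] at hF

/-- The configuration that `F` codes at time `0` is the starting configuration on `w`. -/
def StartsOn (F : ℕ → ℕ) (w : List Bool) : Prop :=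
  lengthAt F 0 = w.length + 1 ∧ headAt F 0 = 1 ∧ stateAt F 0 = 0 ∧
    ∀ j, tapeAt F 0 (j + 1) = encode (w[j]?.map Bool.toNat)

theorem cell_start_t_succ (M : NDTM) (w : List Bool) (j : ℕ) :
    cell ((M.start w).t (j + 1)) = encode (w[j]?.map Bool.toNat) := by
  change cell (w[j]?.map M.bit) = _
  rcases w[j]? with _ | _ | _ <;> rfl

theorem startsOn_iff {M : NDTM} {F : ℕ → ℕ} {w : List Bool} {ρ : M.Config}
    (h : Describes F 0 ρ) : StartsOn F w ↔ ρ = M.start w := by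
  simp only [StartsOn, h.length, h.head, h.state, h.tape, ← M.cell_start_t_succ,
    cell_injective.eq_iff]
  constructor
  · rintro ⟨hn, hp, hq, ht⟩
    obtain ⟨n, t, p, q, outside, _, _, _, _⟩ := ρ
    obtain rfl : t = (M.start w).t := by
      funext j
      cases j with
      | zero => exact outside 0 (.inl rfl)
      | succ j => exact ht j
    obtain rfl : q = 0 := Fin.ext hq
    subst hn hp
    rfl
  · rintro rfl
    exact ⟨rfl, rfl, rfl, fun _ => rfl⟩

theorem arithmetical_startsOn : Arithmetical StartsOn := by
  have zero {α : Type} [Primcodable α] : ArithmeticalFun fun (_ : ℕ → ℕ) (_ : α) => 0 :=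
    arithmeticalFun_const 0
  have letter : Primrec fun a : List Bool × ℕ => encode (a.1[a.2]?.map Bool.toNat) :=
    .comp .encode (.option_map .list_getElem? ((Primrec.dom_finite Bool.toNat).comp .snd).to₂)
  exact .and (.eq (arithmeticalFun_lengthAt zero) (.of_primrec (.comp .succ .list_length)))
    (.and (.eq (arithmeticalFun_headAt zero) (arithmeticalFun_const 1))
    (.and (.eq (arithmeticalFun_stateAt zero) zero)
    (.all (.eq (arithmeticalFun_tapeAt zero (arithmeticalFun_succ (.of_primrec .snd)))
      (.of_primrec letter)))))

theorem isPi11_nonRecurringOn (w : List Bool) :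
    IsPi11 (codesOf fun M qr => M.NonRecurringOn qr w) := by
  simpa [NonRecurringOn] using isPi11_codesOf (I := fun M ρ => ρ = M.start w)
    (arithmetical_startsOn.comp (arithmeticalFun_const w)) fun _ _ _ _ => startsOn_iff

theorem isPi11_universallyNonRecurring :
    IsPi11 (codesOf fun M qr => M.UniversallyNonRecurring qr) := by
  simpa [UniversallyNonRecurring, NonRecurringOn] using
    isPi11_codesOf (I := fun M ρ => ∃ w, ρ = M.start w)
      (.ex (arithmetical_startsOn.comp (.of_primrec .snd)))
      fun _ _ _ _ h => exists_congr fun _ => startsOn_iff h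

theorem isPi11_robustNonRecurring : IsPi11 (codesOf fun M qr => M.RobustNonRecurring qr) := by
  simpa [RobustNonRecurring] using isPi11_codesOf (I := fun _ _ => True) (J := fun _ _ => True)
    (.of_iff (.eq (arithmeticalFun_const 0) (arithmeticalFun_const 0)) (by simp))
    fun _ _ _ _ _ => Iff.rfl

end NDTM

end Membership

section NormalForm

open FirstOrder FirstOrder.Language Encodable

/-! ### A normal form for `Π¹₁` sets -/

/-- The list of the first `k` values of `f`. -/
def initialSegment (f : ℕ → ℕ) (k : ℕ) : List ℕ := (List.range k).map f

theorem length_initialSegment (f : ℕ → ℕ) (k : ℕ) : (initialSegment f k).length = k := by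
  simp [initialSegment]

theorem initialSegment_succ (f : ℕ → ℕ) (k : ℕ) :
    initialSegment f (k + 1) = initialSegment f k ++ [f k] := by
  simp [initialSegment, List.range_succ]

theorem headI_initialSegment_succ (f : ℕ → ℕ) (k : ℕ) : (initialSegment f (k + 1)).headI = f 0 := by
  simp [initialSegment, List.range_succ_eq_map]

theorem map_initialSegment (g f : ℕ → ℕ) (k : ℕ) :
    (initialSegment f k).map g = initialSegment (fun i => g (f i)) k := by
  simp [initialSegment, Function.comp_def]

theorem take_initialSegment (f : ℕ → ℕ) {j k : ℕ} (h : j ≤ k) :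
    (initialSegment f k).take j = initialSegment f j := by
  simp [initialSegment, ← List.map_take, List.take_range, h]

theorem getD_initialSegment (f : ℕ → ℕ) {j k : ℕ} (h : j < k) (d : ℕ) :
    (initialSegment f k).getD j d = f j := by
  simp [initialSegment, List.getD, h]

theorem exists_eq_initialSegment {l : ℕ → List ℕ} (hl : ∀ i, ∃ a, l (i + 1) = l i ++ [a]) :
    ∃ f, ∀ i, l i = initialSegment f ((l 0).length + i) := by
  choose b hb using hl
  refine ⟨fun i => if i < (l 0).length then (l 0).getD i 0 else b (i - (l 0).length), fun i => ?_⟩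
  induction i with
  | zero =>
    refine List.ext_getElem (by simp [initialSegment]) fun j hj _ => ?_
    simp [initialSegment, hj]
  | succ i ih => rw [hb, ih, ← Nat.add_assoc, initialSegment_succ]; simp

theorem primrec_map_unpair_fst : Primrec fun l : List ℕ => l.map fun a => a.unpair.1 :=
  .list_map .id (Primrec.fst.comp (Primrec.unpair.comp .snd)).to₂

theorem primrec_map_unpair_snd : Primrec fun l : List ℕ => l.map fun a => a.unpair.2 :=
  .list_map .id (Primrec.snd.comp (Primrec.unpair.comp .snd)).to₂

/-- A relation between a function `X` and an element `a` of a coded type is a tree projection if it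
has the form `∃ f, ∀ k, R (X↾(k + 1), f↾(k + 1), a)` with a primitive recursive `R`. -/
def IsTreeProjection {α : Type*} [Primcodable α] (P : (ℕ → ℕ) → α → Prop) : Prop :=
  ∃ R : List ℕ × List ℕ × α → Prop, PrimrecPred R ∧ ∀ X a,
    P X a ↔ ∃ f, ∀ k, R (initialSegment X (k + 1), initialSegment f (k + 1), a)

namespace IsTreeProjection

variable {α β : Type*} [Primcodable α] [Primcodable β] {P Q : (ℕ → ℕ) → α → Prop}

theorem of_iff (hP : IsTreeProjection P) (h : ∀ X a, Q X a ↔ P X a) : IsTreeProjection Q :=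
  let ⟨R, hR, hPR⟩ := hP
  ⟨R, hR, fun X a => (h X a).trans (hPR X a)⟩

theorem comp {P : (ℕ → ℕ) → β → Prop} {g : α → β} (hP : IsTreeProjection P) (hg : Primrec g) :
    IsTreeProjection fun X a => P X (g a) :=
  let ⟨_, hR, hPR⟩ := hP
  ⟨_, hR.comp (.pair .fst (.pair (.comp .fst .snd) (hg.comp (.comp .snd .snd)))),
    fun X a => hPR X (g a)⟩

theorem of_primrecPred {p : α → Prop} (hp : PrimrecPred p) : IsTreeProjection fun _ a => p a :=
  ⟨fun r => p r.2.2, hp.comp (.comp .snd .snd), fun X a => by simp⟩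

theorem apply {p : ℕ → Prop} {g : α → ℕ} (hp : PrimrecPred p) (hg : Primrec g) :
    IsTreeProjection fun X a => p (X (g a)) := by
  refine ⟨fun r => r.1.length ≤ g r.2.2 ∨ p (r.1.getD (g r.2.2) 0),
    .or (Primrec.nat_le.comp (.comp .list_length .fst) (hg.comp (.comp .snd .snd)))
      (hp.comp ((Primrec.list_getD 0).comp .fst (hg.comp (.comp .snd .snd)))), fun X a => ?_⟩
  simp only [length_initialSegment]
  constructor
  · refine fun h => ⟨0, fun k => (Nat.lt_or_ge (g a) (k + 1)).symm.imp_right fun hk => ?_⟩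
    rwa [getD_initialSegment X hk]
  · rintro ⟨_, hf⟩
    simpa only [getD_initialSegment X (g a).lt_succ_self] using
      (hf (g a)).resolve_left (Nat.not_succ_le_self _)

theorem and (hP : IsTreeProjection P) (hQ : IsTreeProjection Q) :
    IsTreeProjection fun X a => P X a ∧ Q X a := by
  obtain ⟨R, hR, hPR⟩ := hP
  obtain ⟨S, hS, hQS⟩ := hQ
  refine ⟨fun r => R (r.1, r.2.1.map fun i => i.unpair.1, r.2.2) ∧
    S (r.1, r.2.1.map fun i => i.unpair.2, r.2.2), .and
      (hR.comp (.pair .fst (.pair (primrec_map_unpair_fst.comp (.comp .fst .snd))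
        (.comp .snd .snd))))
      (hS.comp (.pair .fst (.pair (primrec_map_unpair_snd.comp (.comp .fst .snd))
        (.comp .snd .snd)))), fun X a => ?_⟩
  simp only [map_initialSegment, hPR, hQS]
  constructor
  · rintro ⟨⟨f, hf⟩, g, hg⟩
    exact ⟨fun i => Nat.pair (f i) (g i), fun k => by simpa using ⟨hf k, hg k⟩⟩
  · rintro ⟨f, hf⟩
    exact ⟨⟨_, fun k => (hf k).1⟩, _, fun k => (hf k).2⟩

theorem ex {P : (ℕ → ℕ) → α → ℕ → Prop}
    (hP : IsTreeProjection fun X (r : α × ℕ) => P X r.1 r.2) :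
    IsTreeProjection fun X a => ∃ m, P X a m := by
  obtain ⟨R, hR, hPR⟩ := hP
  refine ⟨fun r => R (r.1, r.2.1.map fun i => i.unpair.2, r.2.2, r.2.1.headI.unpair.1),
    hR.comp (.pair .fst (.pair (primrec_map_unpair_snd.comp (.comp .fst .snd))
      (.pair (.comp .snd .snd) (.comp .fst (.comp .unpair (.comp .list_headI
        (.comp .fst .snd))))))), fun X a => ?_⟩
  simp only [map_initialSegment, headI_initialSegment_succ]
  constructor
  · rintro ⟨m, hm⟩
    obtain ⟨f, hf⟩ := (hPR X (a, m)).1 hm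
    exact ⟨fun i => Nat.pair m (f i), fun k => by simpa using hf k⟩
  · rintro ⟨f, hf⟩
    exact ⟨_, (hPR X (a, (f 0).unpair.1)).2 ⟨_, hf⟩⟩

theorem or (hP : IsTreeProjection P) (hQ : IsTreeProjection Q) :
    IsTreeProjection fun X a => P X a ∨ Q X a := by
  obtain ⟨R, hR, hPR⟩ := hP
  obtain ⟨S, hS, hQS⟩ := hQ
  have zero : PrimrecPred fun r : List ℕ × List ℕ × α × ℕ => r.2.2.2 = 0 :=
    Primrec.eq.comp (.comp .snd (.comp .snd .snd)) (.const 0)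
  have forget : Primrec fun r : List ℕ × List ℕ × α × ℕ => (r.1, r.2.1, r.2.2.1) :=
    .pair .fst (.pair (.comp .fst .snd) (.comp .fst (.comp .snd .snd)))
  have choice : IsTreeProjection fun X (r : α × ℕ) =>
      (r.2 = 0 ∧ P X r.1) ∨ (¬r.2 = 0 ∧ Q X r.1) := by
    refine ⟨fun r => (r.2.2.2 = 0 ∧ R (r.1, r.2.1, r.2.2.1)) ∨
      (¬r.2.2.2 = 0 ∧ S (r.1, r.2.1, r.2.2.1)),
      .or (zero.and (hR.comp forget)) (zero.not.and (hS.comp forget)), fun X r => ?_⟩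
    by_cases hr : r.2 = 0 <;> simp [hr, hPR, hQS]
  refine (ex (P := fun X a m => (m = 0 ∧ P X a) ∨ (¬m = 0 ∧ Q X a)) choice).of_iff
    fun X a => ⟨?_, ?_⟩
  · rintro (h | h)
    exacts [⟨0, .inl ⟨rfl, h⟩⟩, ⟨1, .inr ⟨one_ne_zero, h⟩⟩]
  · rintro ⟨m, ⟨-, h⟩ | ⟨-, h⟩⟩
    exacts [.inl h, .inr h]

theorem map_getD_initialSegment (f : ℕ → ℕ) (m k : ℕ) :
    (List.range (k + 1)).map
        (fun j => (initialSegment f (Nat.pair m k + 1)).getD (Nat.pair m j) 0) =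
      initialSegment (fun j => f (Nat.pair m j)) (k + 1) := by
  refine List.map_congr_left fun j hj => getD_initialSegment f ?_ 0
  have hjk : j ≤ k := Nat.lt_succ_iff.1 (List.mem_range.1 hj)
  exact Nat.lt_succ_of_le (hjk.lt_or_eq.elim (fun h => (Nat.pair_lt_pair_right m h).le)
    fun h => h ▸ le_rfl)

theorem all {P : (ℕ → ℕ) → α → ℕ → Prop}
    (hP : IsTreeProjection fun X (r : α × ℕ) => P X r.1 r.2) :
    IsTreeProjection fun X a => ∀ m, P X a m := by
  obtain ⟨R, hR, hPR⟩ := hP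
  have last : Primrec fun r : List ℕ × List ℕ × α => (r.2.1.length - 1).unpair :=
    .comp .unpair (.comp .pred (.comp .list_length (.comp .fst .snd)))
  have length : Primrec fun r : List ℕ × List ℕ × α => (r.2.1.length - 1).unpair.2 + 1 :=
    .comp .succ (.comp .snd last)
  have row : Primrec₂ fun (r : List ℕ × List ℕ × α) j =>
      r.2.1.getD (Nat.pair (r.2.1.length - 1).unpair.1 j) 0 :=
    (Primrec.list_getD 0).comp (.comp .fst (.comp .snd .fst))
      (Primrec₂.natPair.comp (.comp .fst (last.comp .fst)) .snd)
  -- The segments of length `Nat.pair m k + 1` are used to check the segments of length `k + 1` of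
  -- `fun j => f (Nat.pair m j)`, the witness for `m`.
  refine ⟨fun r => R (r.1.take ((r.2.1.length - 1).unpair.2 + 1),
    (List.range ((r.2.1.length - 1).unpair.2 + 1)).map (fun j =>
      r.2.1.getD (Nat.pair (r.2.1.length - 1).unpair.1 j) 0),
    r.2.2, (r.2.1.length - 1).unpair.1), hR.comp (.pair (Primrec.list_take.comp length .fst)
      (.pair (.list_map (.comp .list_range length) row)
        (.pair (.comp .snd .snd) (.comp .fst last)))), fun X a => ?_⟩
  simp only [length_initialSegment, Nat.add_sub_cancel]
  have segments : ∀ f : ℕ → ℕ, (∀ K, R ((initialSegment X (K + 1)).take (K.unpair.2 + 1),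
      (List.range (K.unpair.2 + 1)).map (fun j =>
        (initialSegment f (K + 1)).getD (Nat.pair K.unpair.1 j) 0), a, K.unpair.1)) ↔
      ∀ m k, R (initialSegment X (k + 1), initialSegment (fun j => f (Nat.pair m j)) (k + 1),
        a, m) := fun f => by
    have take (m k : ℕ) : (initialSegment X (Nat.pair m k + 1)).take (k + 1) =
        initialSegment X (k + 1) := take_initialSegment X (by grind [Nat.right_le_pair])
    rw [← Nat.pairEquiv.surjective.forall.symm, Prod.forall]
    simp only [Nat.pairEquiv_apply, Function.uncurry_apply_pair, Nat.unpair_pair,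
      map_getD_initialSegment, take]
  simp only [segments, fun m => hPR X (a, m)]
  constructor
  · intro h
    choose g hg using h
    exact ⟨fun z => g z.unpair.1 z.unpair.2, by simpa using hg⟩
  · exact fun ⟨f, hf⟩ m => ⟨_, hf m⟩

end IsTreeProjection

/-- The sequence of sets coded by a function. -/
def setsOf (X : ℕ → ℕ) (i : ℕ) : Set ℕ := {m | X (Nat.pair i m) ≠ 0}

theorem setsOf_surjective : Function.Surjective setsOf := fun S => by
  classical
  exact ⟨fun z => if z.unpair.2 ∈ S z.unpair.1 then 1 else 0, by ext; simp [setsOf]⟩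

/-- The values of the bound variables, the last variable coming first in the list. -/
def boundValues (n : ℕ) (e : List ℕ) (i : Fin n) : ℕ := e.getD (n - 1 - i) 0

theorem snoc_boundValues (n : ℕ) (e : List ℕ) (a : ℕ) :
    (Fin.snoc (boundValues n e) a : Fin (n + 1) → ℕ) = boundValues (n + 1) (a :: e) := by
  funext i
  refine Fin.lastCases ?_ (fun i => ?_) i
  · simp [boundValues]
  · have : n - i = (n - 1 - i) + 1 := by omega
    simp [boundValues, this]

/-- The formula `φ` holds when the set variables have the values coded by `X`, the free variable
has the value `a.1`, and the bound variables have the values in the list `a.2`. -/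
def Holds {n : ℕ} (φ : arithLang.BoundedFormula Unit n) (X : ℕ → ℕ) (a : ℕ × List ℕ) : Prop :=
  @BoundedFormula.Realize arithLang ℕ (natModel (setsOf X)) _ _ φ (fun _ => a.1)
    (boundValues n a.2)

theorem exists_primrec_realize_term {n : ℕ} (t : arithLang.Term (Unit ⊕ Fin n)) :
    ∃ g : ℕ × List ℕ → ℕ, Primrec g ∧ ∀ X a, @Term.realize arithLang ℕ (natModel X) _
      (Sum.elim (fun _ => a.1) (boundValues n a.2)) t = g a := by
  induction t with
  | var i =>
    rcases i with i | i
    · exact ⟨_, .fst, fun X a => rfl⟩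
    · exact ⟨_, (Primrec.list_getD 0).comp .snd (.const _), fun X a => rfl⟩
  | func f ts ih =>
    choose g hg h using ih
    cases f with
    | zero => exact ⟨fun _ => 0, .const 0, fun X a => rfl⟩
    | one => exact ⟨fun _ => 1, .const 1, fun X a => rfl⟩
    | add => exact ⟨fun a => g 0 a + g 1 a, Primrec.nat_add.comp (hg 0) (hg 1),
        fun X a => congrArg₂ (· + ·) (h 0 X a) (h 1 X a)⟩
    | mul => exact ⟨fun a => g 0 a * g 1 a, Primrec.nat_mul.comp (hg 0) (hg 1),
        fun X a => congrArg₂ (· * ·) (h 0 X a) (h 1 X a)⟩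

theorem exists_primrec_holds_equal {n : ℕ} (t s : arithLang.Term (Unit ⊕ Fin n)) :
    ∃ p : ℕ × List ℕ → Prop, PrimrecPred p ∧ ∀ X a, Holds (.equal t s) X a ↔ p a := by
  obtain ⟨f, hf, ht⟩ := exists_primrec_realize_term t
  obtain ⟨g, hg, hs⟩ := exists_primrec_realize_term s
  refine ⟨_, Primrec.eq.comp hf hg, fun X a => ?_⟩
  rw [← ht (setsOf X), ← hs (setsOf X)]
  rfl

theorem exists_primrec_holds_set {n i : ℕ} (ts : Fin 1 → arithLang.Term (Unit ⊕ Fin n)) :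
    ∃ g : ℕ × List ℕ → ℕ, Primrec g ∧
      ∀ X a, Holds (.rel (ArithRel.set i) ts) X a ↔ X (g a) ≠ 0 := by
  obtain ⟨g, hg, h⟩ := exists_primrec_realize_term (ts 0)
  refine ⟨fun a => Nat.pair i (g a), Primrec₂.natPair.comp (.const i) hg, fun X a => ?_⟩
  dsimp only
  rw [← h (setsOf X)]
  rfl

theorem holds_imp {n : ℕ} {φ ψ : arithLang.BoundedFormula Unit n} {X : ℕ → ℕ} {a : ℕ × List ℕ} :
    Holds (φ.imp ψ) X a ↔ (Holds φ X a → Holds ψ X a) := Iff.rfl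

theorem holds_all {n : ℕ} {φ : arithLang.BoundedFormula Unit (n + 1)} {X : ℕ → ℕ}
    {a : ℕ × List ℕ} : Holds φ.all X a ↔ ∀ m, Holds φ X (a.1, m :: a.2) := by
  simp only [Holds, ← snoc_boundValues]
  rfl

theorem isTreeProjection_holds {n : ℕ} (φ : arithLang.BoundedFormula Unit n) :
    IsTreeProjection (Holds φ) ∧ IsTreeProjection fun X a => ¬Holds φ X a := by
  induction φ with
  | falsum =>
    have never : PrimrecPred fun _ : ℕ × List ℕ => False :=
      .of_eq (Primrec.eq.comp (.const 0) (.const 1)) fun _ => by simp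
    exact ⟨.of_primrecPred never, .of_primrecPred never.not⟩
  | equal t s =>
    obtain ⟨p, hp, h⟩ := exists_primrec_holds_equal t s
    exact ⟨(IsTreeProjection.of_primrecPred hp).of_iff h,
      (IsTreeProjection.of_primrecPred hp.not).of_iff fun X a => not_congr (h X a)⟩
  | rel R ts =>
    cases R with
    | set i =>
      obtain ⟨g, hg, h⟩ := exists_primrec_holds_set (i := i) ts
      have zero : PrimrecPred fun m : ℕ => m = 0 := Primrec.eq.comp .id (.const 0)
      exact ⟨(IsTreeProjection.apply zero.not hg).of_iff h,
        (IsTreeProjection.apply zero hg).of_iff fun X a => (not_congr (h X a)).trans not_not⟩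
  | imp φ ψ hφ hψ =>
    exact ⟨(hφ.2.or hψ.1).of_iff fun X a => holds_imp.trans imp_iff_not_or,
      (hφ.1.and hψ.2).of_iff fun X a => (not_congr holds_imp).trans Classical.not_imp⟩
  | all φ hφ =>
    have push : Primrec fun r : (ℕ × List ℕ) × ℕ => (r.1.1, r.2 :: r.1.2) :=
      .pair (.comp .fst .fst) (Primrec.list_cons.comp .snd (.comp .snd .fst))
    exact ⟨(IsTreeProjection.all (hφ.1.comp push)).of_iff fun X a => holds_all,
      (IsTreeProjection.ex (hφ.2.comp push)).of_iff fun X a =>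
        (not_congr holds_all).trans not_forall⟩

theorem IsPi11.exists_initialSegment {B : Set ℕ} (hB : IsPi11 B) :
    ∃ R : ℕ × List ℕ → Prop, PrimrecPred R ∧
      ∀ n, n ∉ B ↔ ∃ h, ∀ k, R (n, initialSegment h (k + 1)) := by
  obtain ⟨φ, hφ⟩ := hB
  obtain ⟨R, hR, hφR⟩ := (isTreeProjection_holds φ).2
  refine ⟨fun r => R (r.2.map fun i => i.unpair.1, r.2.map fun i => i.unpair.2, r.1, []),
    hR.comp (.pair (primrec_map_unpair_fst.comp .snd) (.pair (primrec_map_unpair_snd.comp .snd)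
      (.pair .fst (.const [])))), fun n => ?_⟩
  have not_holds : n ∉ B ↔ ∃ X, ¬Holds φ X (n, []) := by
    rw [hφ, not_forall, setsOf_surjective.exists]
    exact exists_congr fun X => not_congr <| iff_of_eq <| congrArg
      (@BoundedFormula.Realize arithLang ℕ (natModel (setsOf X)) _ _ φ _) (Subsingleton.elim _ _)
  simp only [not_holds, hφR, map_initialSegment]
  constructor
  · rintro ⟨X, f, hf⟩
    exact ⟨fun i => Nat.pair (X i) (f i), fun k => by simpa using hf k⟩
  · rintro ⟨h, hh⟩
    exact ⟨_, _, hh⟩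

/-- The list `l'` extends `l` by one element, and all its nonempty initial segments satisfy `p`. -/
def IsExtension (p : List ℕ → Prop) (l l' : List ℕ) : Prop :=
  l'.length = l.length + 1 ∧ l'.take l.length = l ∧ ∀ j < l'.length, p (l'.take (j + 1))

theorem isExtension_initialSegment {p : List ℕ → Prop} {f : ℕ → ℕ}
    (hf : ∀ k, p (initialSegment f (k + 1))) (i : ℕ) :
    IsExtension p (initialSegment f i) (initialSegment f (i + 1)) := by
  simp only [IsExtension, length_initialSegment]
  refine ⟨trivial, take_initialSegment f i.le_succ, fun j hj => ?_⟩
  rw [take_initialSegment f hj]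
  exact hf j

theorem IsExtension.exists_eq_append {p : List ℕ → Prop} {l l' : List ℕ} (h : IsExtension p l l') :
    ∃ a, l' = l ++ [a] := by
  obtain ⟨length_eq, take_eq, -⟩ := h
  obtain ⟨a, ha⟩ : ∃ a, l'.drop l.length = [a] := List.length_eq_one_iff.1 (by simp [length_eq])
  exact ⟨a, by rw [← ha, ← take_eq, List.length_take_of_le (by omega), List.take_append_drop]⟩

theorem exists_initialSegment_of_isExtension {p : List ℕ → Prop} {l : ℕ → List ℕ}
    (hl : ∀ i, IsExtension p (l i) (l (i + 1))) : ∃ f, ∀ k, p (initialSegment f (k + 1)) := by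
  obtain ⟨f, hf⟩ := exists_eq_initialSegment fun i => (hl i).exists_eq_append
  refine ⟨f, fun k => ?_⟩
  have h := (hl k).2.2 k
  rw [hf (k + 1), length_initialSegment, take_initialSegment _ (by omega)] at h
  exact h (by omega)

theorem primrecPred_isExtension {R : ℕ × List ℕ → Prop} (hR : PrimrecPred R) :
    PrimrecPred fun a : ℕ × List ℕ × List ℕ =>
      IsExtension (fun l => R (a.1, l)) a.2.1 a.2.2 := by
  have l : Primrec fun a : ℕ × List ℕ × List ℕ => a.2.1 := .comp .fst .snd
  have l' : Primrec fun a : ℕ × List ℕ × List ℕ => a.2.2 := .comp .snd .snd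
  have segment : PrimrecRel fun (j : ℕ) (a : ℕ × List ℕ × List ℕ) =>
      R (a.1, a.2.2.take (j + 1)) :=
    hR.comp (.pair (.comp .fst .snd) (Primrec.list_take.comp (.comp .succ .fst) (l'.comp .snd)))
  exact .and (Primrec.eq.comp (.comp .list_length l') (.comp .succ (.comp .list_length l))) <|
    .and (Primrec.eq.comp (Primrec.list_take.comp (.comp .list_length l) l') l) <|
    (segment.forall_mem_list.comp (.comp .list_range (.comp .list_length l')) .id).of_eq
      fun a => by simp

theorem IsPi11.exists_chain {B : Set ℕ} (hB : IsPi11 B) :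
    ∃ T : ℕ → ℕ → ℕ → Prop, PrimrecPred (fun a : ℕ × ℕ × ℕ => T a.1 a.2.1 a.2.2) ∧
      (∀ n, n ∉ B → ∃ σ : ℕ → ℕ, σ 0 = 0 ∧ ∀ i, T n (σ i) (σ (i + 1))) ∧
      ∀ n (σ : ℕ → ℕ), (∀ i, T n (σ i) (σ (i + 1))) → n ∉ B := by
  obtain ⟨R, hR, hBR⟩ := hB.exists_initialSegment
  let list : ℕ → List ℕ := Denumerable.ofNat (List ℕ)
  have primrec_list : Primrec list := .ofNat _
  refine ⟨fun n s t => IsExtension (fun l => R (n, l)) (list s) (list t),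
    (primrecPred_isExtension hR).comp (.pair .fst (.pair (primrec_list.comp (.comp .fst .snd))
      (primrec_list.comp (.comp .snd .snd)))), fun n hn => ?_, fun n σ hσ =>
    (hBR n).2 (exists_initialSegment_of_isExtension hσ)⟩
  obtain ⟨f, hf⟩ := (hBR n).1 hn
  refine ⟨fun i => encode (initialSegment f i), rfl, fun i => ?_⟩
  simpa only [list, Denumerable.ofNat_encode] using
    isExtension_initialSegment (p := fun l => R (n, l)) hf i

end NormalForm

section RegisterPrograms

open Function

/-! ### Register programs -/

/-- Programs for register machines with registers numbered by `ℕ`. -/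
inductive Prog
  | skip
  | inc (i : ℕ)
  | seq (p q : Prog)
  | loop (i : ℕ) (p : Prog)

namespace Prog

/-- `Eval p v w` says that the program `p` transforms the register contents `v` into `w`. The loop
`loop i p` decrements the register `i` and performs `p` as long as the register is not zero. -/
inductive Eval : Prog → (ℕ → ℕ) → (ℕ → ℕ) → Prop
  | skip (v) : Eval skip v v
  | inc (i v) : Eval (inc i) v (update v i (v i + 1))
  | seq {p q u v w} : Eval p u v → Eval q v w → Eval (seq p q) u w
  | loop_zero {i p v} : v i = 0 → Eval (loop i p) v v
  | loop_succ {i p u v w n} : u i = n + 1 → Eval p (update u i n) v → Eval (loop i p) v w →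
      Eval (loop i p) u w

theorem Eval.of_eq {p : Prog} {u v w : ℕ → ℕ} (h : Eval p u v) (e : v = w) : Eval p u w := e ▸ h

theorem Eval.loop {i : ℕ} {p : Prog} (s : ℕ → ℕ → ℕ) (hs : ∀ k, s k i = k) (n : ℕ)
    (hp : ∀ k < n, Eval p (update (s (k + 1)) i k) (s k)) : Eval (loop i p) (s n) (s 0) := by
  induction n with
  | zero => exact .loop_zero (hs 0)
  | succ n ih =>
    exact .loop_succ (hs _) (hp n n.lt_succ_self) (ih fun k hk => hp k (hk.trans n.lt_succ_self))

/-- The program that sets the register `i` to zero. -/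
def clear (i : ℕ) : Prog := loop i skip

theorem eval_clear (i : ℕ) (v : ℕ → ℕ) : Eval (clear i) v (update v i 0) := by
  have h := Eval.loop (i := i) (p := skip) (fun k => update v i k) (by simp) (v i)
    fun k _ => by simpa using Eval.skip (update v i k)
  simpa only [clear, update_eq_self] using h

/-- The program that adds the register `i` to the register `j` and sets `i` to zero. -/
def move (i j : ℕ) : Prog := loop i (inc j)

theorem eval_move {i j : ℕ} (hij : i ≠ j) (v : ℕ → ℕ) :
    Eval (move i j) v (update (update v i 0) j (v j + v i)) := by
  have h := Eval.loop (i := i) (p := inc j) (fun k => update (update v i k) j (v j + (v i - k)))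
    (by simp [hij]) (v i) fun k hk => (Eval.inc _ _).of_eq (by grind)
  simpa only [move, update_eq_self, Nat.sub_self, Nat.add_zero, Nat.sub_zero] using h

/-- The program that adds the register `i` to the register `j`, using the auxiliary register `b`. -/
def copy (i j b : ℕ) : Prog := seq (loop i (seq (inc j) (inc b))) (move b i)

theorem eval_copy {i j b : ℕ} (hij : i ≠ j) (hib : i ≠ b) (hjb : j ≠ b) {v : ℕ → ℕ}
    (hv : v b = 0) : Eval (copy i j b) v (update v j (v j + v i)) := by
  have h := Eval.loop (i := i) (p := seq (inc j) (inc b))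
    (fun k => update (update (update v i k) j (v j + (v i - k))) b (v i - k))
    (by simp [hij, hib]) (v i) fun k hk => (Eval.seq (.inc _ _) (.inc _ _)).of_eq (by grind)
  have update_b : update v b 0 = v := by rw [← hv, update_eq_self]
  simp only [update_eq_self, Nat.sub_self, Nat.add_zero, Nat.sub_zero, update_b] at h
  exact (h.seq (eval_move hib.symm _)).of_eq (by grind)

/-- The program that sets the registers `b, …, b + n - 1` to zero. -/
def clearRange (b : ℕ) : ℕ → Prog
  | 0 => skip
  | n + 1 => seq (clearRange b n) (clear (b + n))

theorem eval_clearRange (b n : ℕ) (v : ℕ → ℕ) :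
    Eval (clearRange b n) v fun r => if b ≤ r ∧ r < b + n then 0 else v r := by
  induction n with
  | zero => exact (Eval.skip v).of_eq (by grind)
  | succ n ih => exact (ih.seq (eval_clear _ _)).of_eq (by grind)

/-- The function `f` can be computed by programs, for any choice of the input registers `a`, of the
output register `o` and of the bound `b` from which on all registers may be used as workspace, to
be left empty. The result is added to the output register. -/
def Computes {n : ℕ} (f : List.Vector ℕ n → ℕ) : Prop :=
  ∀ (a : Fin n → ℕ) (o b : ℕ), (∀ i, a i < b) → o < b → (∀ i, a i ≠ o) →
    ∃ p, ∀ v : ℕ → ℕ, (∀ r, b ≤ r → v r = 0) →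
      Eval p v (update v o (v o + f (List.Vector.ofFn fun i => v (a i))))

theorem Computes.exists_eval_all {m n : ℕ} {g : Fin n → List.Vector ℕ m → ℕ}
    (hg : ∀ i, Computes (g i)) {a : Fin m → ℕ} {b : ℕ} (ha : ∀ i, a i < b) :
    ∃ p, ∀ v : ℕ → ℕ, (∀ r, b ≤ r → v r = 0) → Eval p v fun r =>
      if h : b ≤ r ∧ r - b < n then g ⟨r - b, h.2⟩ (List.Vector.ofFn fun i => v (a i))
      else v r := by
  induction n with
  | zero => exact ⟨skip, fun v _ => (Eval.skip v).of_eq (by simp)⟩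
  | succ n ih =>
    obtain ⟨p, hp⟩ := ih fun i => hg i.castSucc
    obtain ⟨q, hq⟩ := hg (Fin.last n) a (b + n) (b + n + 1) (fun i => by grind) (by grind)
      fun i => by grind
    refine ⟨p.seq q, fun v hv => ((hp v hv).seq (hq _ fun r hr => ?_)).of_eq ?_⟩
    · rw [dif_neg (by omega), hv r (by omega)]
    · have inputs : ∀ i, ¬(b ≤ a i ∧ a i - b < n) := fun i => by grind
      have output : v (b + n) = 0 := hv _ (by omega)
      funext r
      rcases eq_or_ne r (b + n) with rfl | hr
      · simp [inputs, output, Fin.last]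
      · simp only [update_of_ne hr, Fin.castSucc_mk]
        split_ifs <;> first | rfl | omega

theorem Computes.comp {m n : ℕ} {f : List.Vector ℕ n → ℕ} {g : Fin n → List.Vector ℕ m → ℕ}
    (hf : Computes f) (hg : ∀ i, Computes (g i)) :
    Computes fun a => f (List.Vector.ofFn fun i => g i a) := by
  intro a o b ha ho hao
  obtain ⟨p, hp⟩ := Computes.exists_eval_all hg ha
  obtain ⟨q, hq⟩ := hf (fun i => b + i) o (b + n) (fun i => by omega) (by omega)
    fun i => by omega
  refine ⟨(p.seq q).seq (clearRange b n), fun v hv => (((hp v hv).seq (hq _ fun r hr => ?_)).seq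
    (eval_clearRange b n _)).of_eq ?_⟩
  · rw [dif_neg (by omega), hv r (by omega)]
  · funext r
    rcases eq_or_ne r o with rfl | hr
    · simp [show ¬b ≤ r by omega]
    · simp only [update_of_ne hr]
      grind

/-- The register contents `v`, modified such that `b`, `b + 1` and `b + 2` hold the number `k` of
remaining steps, the current value `z` and the number `y` of performed steps of a recursion. -/
def recState (v : ℕ → ℕ) (b k z y : ℕ) : ℕ → ℕ :=
  update (update (update v b k) (b + 1) z) (b + 2) y

theorem recState_apply (v : ℕ → ℕ) (b k z y r : ℕ) : recState v b k z y r =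
    if r = b + 2 then y else if r = b + 1 then z else if r = b then k else v r := by
  simp only [recState, update_apply]

theorem Computes.exists_eval_step {n : ℕ} {g : List.Vector ℕ (n + 2) → ℕ} (hg : Computes g)
    {a : Fin n → ℕ} {b : ℕ} (ha : ∀ i, a i < b) :
    ∃ p, ∀ v : ℕ → ℕ, (∀ r, b ≤ r → v r = 0) → ∀ k z y, Eval p (recState v b k z y)
      (recState v b k (g (y ::ᵥ z ::ᵥ List.Vector.ofFn fun i => v (a i))) (y + 1)) := by
  obtain ⟨q, hq⟩ := hg (Fin.cons (b + 2) (Fin.cons (b + 1) a)) (b + 3) (b + 4)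
    (Fin.cases (by simp) (Fin.cases (by simp) fun i => by simpa using (ha i).trans (by omega)))
    (by omega)
    (Fin.cases (by simp) (Fin.cases (by simp) fun i => by
      simpa using ((ha i).trans (by omega)).ne))
  refine ⟨(q.seq (clear (b + 1))).seq ((move (b + 3) (b + 1)).seq (inc (b + 2))),
    fun v hv k z y => (((hq _ fun r hr => ?_).seq (eval_clear _ _)).seq
      ((eval_move (by omega) _).seq (.inc _ _))).of_eq ?_⟩
  · have := hv r (by omega)
    grind [recState_apply]
  · have inputs : (List.Vector.ofFn fun i : Fin (n + 2) => recState v b k z y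
        ((Fin.cons (b + 2) (Fin.cons (b + 1) a) : Fin (n + 2) → ℕ) i)) =
        y ::ᵥ z ::ᵥ List.Vector.ofFn fun i => v (a i) := by
      have unchanged (i : Fin n) : recState v b k z y (a i) = v (a i) := by
        have := ha i
        grind [recState_apply]
      simp [List.Vector.ofFn, unchanged, recState_apply]
    have := hv (b + 3) (by omega)
    rw [inputs]
    funext r
    simp only [update_apply, recState_apply]
    split_ifs <;> grind

theorem Computes.exists_eval_rec {n : ℕ} {g : List.Vector ℕ (n + 2) → ℕ} (hg : Computes g)
    {a : Fin n → ℕ} {b : ℕ} (ha : ∀ i, a i < b) :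
    ∃ p, ∀ v : ℕ → ℕ, (∀ r, b ≤ r → v r = 0) → ∀ N z, Eval p (recState v b N z 0)
      (recState v b 0 (N.rec z fun y z => g (y ::ᵥ z ::ᵥ List.Vector.ofFn fun i => v (a i)))
        N) := by
  obtain ⟨q, hq⟩ := hg.exists_eval_step ha
  refine ⟨loop b q, fun v hv N z => ?_⟩
  let R : ℕ → ℕ := fun k => k.rec z fun y z => g (y ::ᵥ z ::ᵥ List.Vector.ofFn fun i => v (a i))
  have h := Eval.loop (i := b) (p := q) (fun k => recState v b k (R (N - k)) (N - k))
    (by simp [recState]) N fun k hk => ?_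
  · simpa [R] using h
  · obtain ⟨y, rfl⟩ : ∃ y, N = y + (k + 1) := ⟨_, (Nat.sub_add_cancel hk).symm⟩
    rw [Nat.add_sub_cancel, show y + (k + 1) - k = y + 1 by omega]
    convert hq v hv k (R y) y using 1
    funext r
    simp only [update_apply, recState_apply]
    grind

theorem Computes.prec {n : ℕ} {f : List.Vector ℕ n → ℕ} {g : List.Vector ℕ (n + 2) → ℕ}
    (hf : Computes f) (hg : Computes g) :
    Computes fun v : List.Vector ℕ (n + 1) =>
      v.head.rec (f v.tail) fun y z => g (y ::ᵥ z ::ᵥ v.tail) := by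
  intro a o b ha ho _
  have ha_zero := ha 0
  obtain ⟨p, hp⟩ := hf (fun i => a i.succ) (b + 1) (b + 4) (fun i => by grind)
    (by omega) fun i => by grind
  obtain ⟨q, hq⟩ := hg.exists_eval_rec fun i => ha i.succ
  refine ⟨(((p.seq (copy (a 0) b (b + 4))).seq q).seq (move (b + 1) o)).seq (clear (b + 2)),
    fun v hv => ?_⟩
  have zero_of_le (r : ℕ) : v (b + r) = 0 := hv _ (b.le_add_right r)
  have zero := zero_of_le 0
  have one := zero_of_le 1
  have two := zero_of_le 2
  have start : Eval (p.seq (copy (a 0) b (b + 4))) v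
      (recState v b (v (a 0)) (f (List.Vector.ofFn fun i => v (a i.succ))) 0) := by
    refine ((hp v fun r hr => hv r (by omega)).seq (eval_copy (by omega) (by omega) (by omega)
      ?_)).of_eq ?_
    · rw [update_of_ne (by omega), zero_of_le]
    · funext r
      simp only [update_apply, recState_apply]
      split_ifs <;> grind
  refine (((start.seq (hq v hv _ _)).seq (eval_move (by omega) _)).seq (eval_clear _ _)).of_eq ?_
  simp only [List.Vector.ofFn, List.Vector.head_cons, List.Vector.tail_cons]
  funext r
  simp only [update_apply, recState_apply]
  split_ifs <;> grind

theorem computes_of_primrec' {n : ℕ} {f : List.Vector ℕ n → ℕ} (hf : Nat.Primrec' f) :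
    Computes f := by
  induction hf with
  | zero => exact fun a o b _ _ _ => ⟨skip, fun v _ => by simpa using Eval.skip v⟩
  | succ =>
    intro a o b ha ho hao
    refine ⟨(copy (a 0) o b).seq (inc o), fun v hv => ((eval_copy (hao 0) (ha 0).ne ho.ne
      (hv b le_rfl)).seq (.inc _ _)).of_eq ?_⟩
    simp [List.Vector.ofFn, Nat.add_assoc]
  | get i =>
    intro a o b ha ho hao
    refine ⟨copy (a i) o b, fun v hv => (eval_copy (hao i) (ha i).ne ho.ne (hv b le_rfl)).of_eq ?_⟩
    simp
  | comp g _ _ hf hg => exact hf.comp hg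
  | prec _ _ hf hg => exact hf.prec hg

end Prog

end RegisterPrograms

section CounterMachines

open Function Relation

/-! ### Counter machines -/

/-- Instructions of nondeterministic counter machines. The instruction `dec i l₀ l₁` jumps to `l₀`
if the counter `i` is zero, and otherwise decrements it and jumps to `l₁`; `jump l₁ l₂` chooses
between two labels. -/
inductive Instr
  | inc (i l : ℕ)
  | dec (i l₀ l₁ : ℕ)
  | jump (l₁ l₂ : ℕ)
  | halt

namespace Instr

/-- The possible next labels and counter values when an instruction is executed. -/
def next : Instr → (ℕ → ℕ) → Set (ℕ × (ℕ → ℕ))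
  | inc i l, v => {(l, update v i (v i + 1))}
  | dec i l₀ l₁, v => if v i = 0 then {(l₀, v)} else {(l₁, update v i (v i - 1))}
  | jump l₁ l₂, v => {(l₁, v), (l₂, v)}
  | halt, _ => ∅

/-- The instruction only uses counters below `K` and labels below `B`. -/
def Bounded (K B : ℕ) : Instr → Prop
  | inc i l => i < K ∧ l < B
  | dec i l₀ l₁ => i < K ∧ l₀ < B ∧ l₁ < B
  | jump l₁ l₂ => l₁ < B ∧ l₂ < B
  | halt => True

/-- `Det P s t` says that the counter machine `P`, whose instruction with label `l` is `P l`, passes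
from `s` to `t` without making choices. -/
def Det (P : ℕ → Instr) : ℕ × (ℕ → ℕ) → ℕ × (ℕ → ℕ) → Prop :=
  ReflTransGen fun s t => (P s.1).next s.2 = {t}

/-- The list `L` of instructions is found in the counter machine `P` from the label `s` on. -/
def Located (P : ℕ → Instr) (L : List Instr) (s : ℕ) : Prop :=
  ∀ j I, L[j]? = some I → P (s + j) = I

variable {P : ℕ → Instr} {L L' : List Instr} {I : Instr} {s : ℕ}

theorem located_cons : Located P (I :: L) s ↔ P s = I ∧ Located P L (s + 1) := by
  constructor
  · exact fun h => ⟨h 0 I rfl, fun j J hj => by rw [Nat.add_assoc, Nat.add_comm 1]; exact h _ J hj⟩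
  · rintro ⟨h, hL⟩ (_ | j) J hj
    · exact h.trans (Option.some.inj hj)
    · rw [Nat.add_comm j, ← Nat.add_assoc]
      exact hL j J hj

theorem located_append :
    Located P (L ++ L') s ↔ Located P L s ∧ Located P L' (s + L.length) := by
  induction L generalizing s with
  | nil => simp [Located]
  | cons I L ih => simp only [List.cons_append, located_cons, ih, List.length_cons, and_assoc,
      Nat.add_assoc, Nat.add_comm 1]

end Instr

namespace Prog

open Instr

/-- The number of instructions of the compiled program. -/
def size : Prog → ℕ
  | skip => 1
  | inc _ => 1
  | seq p q => p.size + q.size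
  | loop _ p => p.size + 1

theorem size_pos (p : Prog) : 0 < p.size := by
  induction p with
  | seq p q hp _ => exact Nat.add_pos_left hp _
  | _ => exact Nat.succ_pos _

/-- The instructions of a counter machine that performs the program `p` when entered at the label
`s`, where they start, and then leaves to the label `e`. -/
def compile : Prog → ℕ → ℕ → List Instr
  | skip, _, e => [.jump e e]
  | inc i, _, e => [.inc i e]
  | seq p q, s, e => p.compile s (s + p.size) ++ q.compile (s + p.size) e
  | loop i p, s, e => .dec i e (s + 1) :: p.compile (s + 1) s

theorem length_compile (p : Prog) (s e : ℕ) : (p.compile s e).length = p.size := by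
  induction p generalizing s e with
  | skip => rfl
  | inc i => rfl
  | seq p q hp hq => rw [compile, List.length_append, hp, hq, size]
  | loop i p hp => rw [compile, List.length_cons, hp, size]

/-- A number above all registers that occur in a program. -/
def bound : Prog → ℕ
  | skip => 0
  | inc i => i + 1
  | seq p q => max p.bound q.bound
  | loop i p => max (i + 1) p.bound

theorem bounded_compile (p : Prog) {K B s e : ℕ} (hK : p.bound ≤ K) (hs : s + p.size ≤ B)
    (he : e < B) : ∀ I ∈ p.compile s e, I.Bounded K B := by
  induction p generalizing s e with
  | skip => simp [compile, Bounded, he]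
  | inc i => simpa [compile, Bounded, he, bound] using hK
  | seq p q hp hq =>
    have := q.size_pos
    rw [bound, max_le_iff] at hK
    rw [size] at hs
    rw [compile, List.forall_mem_append]
    exact ⟨hp hK.1 (by omega) (by omega), hq hK.2 (by omega) he⟩
  | loop i p hp =>
    have := p.size_pos
    rw [bound, max_le_iff] at hK
    rw [size] at hs
    rw [compile, List.forall_mem_cons]
    exact ⟨⟨hK.1, he, by omega⟩, hp hK.2 (by omega) (by omega)⟩

theorem Eval.det {P : ℕ → Instr} {p : Prog} {v w : ℕ → ℕ} (h : Eval p v w) {s e : ℕ}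
    (hP : Located P (p.compile s e) s) : Det P (s, v) (e, w) := by
  induction h generalizing s e with
  | skip v => exact .single (by simp [(located_cons.1 hP).1, Instr.next])
  | inc i v => exact .single (by simp [(located_cons.1 hP).1, Instr.next])
  | @seq p q _ _ _ _ _ hp hq =>
    rw [compile, located_append, length_compile] at hP
    exact (hp hP.1).trans (hq hP.2)
  | loop_zero zero => exact .single (by simp [(located_cons.1 hP).1, Instr.next, zero])
  | loop_succ succ _ _ body rest =>
    exact .head (by simp [(located_cons.1 hP).1, Instr.next, succ])
      ((body (located_cons.1 hP).2).trans (rest hP))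

end Prog

end CounterMachines

section SearchPrograms

open Function Instr Prog

/-! ### The search program -/

namespace Search

/-- The number of counters of the search program. -/
def numRegs (p : Prog) : ℕ := max p.bound 4

theorem four_le_numRegs (p : Prog) : 4 ≤ numRegs p := le_max_right _ _

/-- The program that moves the register `2` to the register `1` and clears all others. -/
def reset (p : Prog) : Prog :=
  (((clear 1).seq (move 2 1)).seq (clear 0)).seq (clearRange 2 (numRegs p - 2))

theorem bound_clearRange {b n K : ℕ} (h : b + n ≤ K) : (clearRange b n).bound ≤ K := by
  induction n with
  | zero => exact Nat.zero_le K
  | succ n ih =>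
    simp only [clearRange, bound, Prog.clear, max_le_iff]
    exact ⟨ih (by omega), by omega, by omega⟩

theorem bound_reset (p : Prog) : (reset p).bound ≤ numRegs p := by
  have := four_le_numRegs p
  have := bound_clearRange (b := 2) (n := numRegs p - 2) (K := numRegs p) (by omega)
  simp only [reset, bound, Prog.clear, Prog.move]
  omega

theorem eval_reset (p : Prog) {v : ℕ → ℕ} (hv : ∀ r, numRegs p ≤ r → v r = 0) :
    Eval (reset p) v (update 0 1 (v 2)) := by
  have := four_le_numRegs p
  refine ((((eval_clear 1 v).seq (eval_move (by decide) _)).seq (eval_clear 0 _)).seq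
    (eval_clearRange 2 _ _)).of_eq ?_
  funext r
  have := hv r
  simp only [update_apply, Pi.zero_apply]
  split_ifs <;> omega

/-- The label of the instruction that evaluates the result of the check. -/
def testLabel (p : Prog) : ℕ := 2 + p.size

/-- The label that is visited once in each round. -/
def roundLabel (p : Prog) : ℕ := testLabel p + 1

/-- The label of the halting instruction. -/
def haltLabel (p : Prog) : ℕ := roundLabel p + (reset p).size

/-- The label of the nondeterministic jump. -/
def guessLabel (p : Prog) : ℕ := haltLabel p + 1

theorem roundLabel_lt_guessLabel (p : Prog) : roundLabel p < guessLabel p :=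
  Nat.lt_succ_of_le (Nat.le_add_right _ _)

/-- The instructions of the search program with the labels `1, …, guessLabel p`, which do not depend
on the input. -/
def fixedPart (p : Prog) : List Instr :=
  .inc 2 (guessLabel p) :: (p.compile 2 (testLabel p) ++
    .dec 3 (haltLabel p) (roundLabel p) :: ((reset p).compile (roundLabel p) 0 ++
      [.halt, .jump 1 2]))

theorem length_fixedPart (p : Prog) : (fixedPart p).length = guessLabel p := by
  simp only [fixedPart, List.length_append, length_compile, List.length_cons, List.length_nil,
    guessLabel, haltLabel, roundLabel, testLabel]
  omega

/-- The search program for the input `n` with the check `p`. Each round begins at the label `0` with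
all counters zero except for the counter `1`. It writes `n` to the counter `0`, guesses a number in
the counter `2` and performs `p`. If the result, in the counter `3`, is nonzero, then `roundLabel p`
is visited and the next round begins with the guessed number in the counter `1`. -/
def program (p : Prog) (n : ℕ) : ℕ → Instr
  | 0 => .jump (guessLabel p + n) (guessLabel p + n)
  | l + 1 => (fixedPart p).getD l (.inc 0 l)

theorem program_zero (p : Prog) (n : ℕ) :
    program p n 0 = .jump (guessLabel p + n) (guessLabel p + n) := rfl

theorem program_guessLabel_add_succ (p : Prog) (n j : ℕ) :
    program p n (guessLabel p + (j + 1)) = .inc 0 (guessLabel p + j) :=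
  List.getD_eq_default _ _ (by rw [length_fixedPart]; exact Nat.le_add_right _ _)

theorem located_fixedPart (p : Prog) (n : ℕ) : Located (program p n) (fixedPart p) 1 :=
  fun j I hj => by rw [Nat.add_comm, program, List.getD, hj, Option.getD_some]

theorem program_layout (p : Prog) (n : ℕ) :
    program p n 1 = .inc 2 (guessLabel p) ∧
    Located (program p n) (p.compile 2 (testLabel p)) 2 ∧
    program p n (testLabel p) = .dec 3 (haltLabel p) (roundLabel p) ∧
    Located (program p n) ((reset p).compile (roundLabel p) 0) (roundLabel p) ∧
    program p n (haltLabel p) = .halt ∧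
    program p n (guessLabel p) = .jump 1 2 := by
  have h := located_fixedPart p n
  simp only [fixedPart, located_cons, located_append, length_compile] at h
  obtain ⟨count, check, test, reset, halt, guess, -⟩ := h
  exact ⟨count, check, test, reset, halt, guess⟩

theorem program_one (p : Prog) (n : ℕ) : program p n 1 = .inc 2 (guessLabel p) :=
  (program_layout p n).1

theorem program_haltLabel (p : Prog) (n : ℕ) : program p n (haltLabel p) = .halt :=
  (program_layout p n).2.2.2.2.1

theorem program_guessLabel (p : Prog) (n : ℕ) : program p n (guessLabel p) = .jump 1 2 :=
  (program_layout p n).2.2.2.2.2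

theorem bounded_fixedPart (p : Prog) {B : ℕ} (hB : guessLabel p < B) :
    ∀ I ∈ fixedPart p, I.Bounded (numRegs p) B := by
  have := four_le_numRegs p
  have labels : guessLabel p = 2 + p.size + 1 + (reset p).size + 1 := rfl
  simp only [fixedPart, List.forall_mem_cons, List.forall_mem_append]
  simp only [haltLabel, roundLabel, testLabel]
  exact ⟨⟨by omega, hB⟩, bounded_compile p (le_max_left _ _) (by omega) (by omega),
    ⟨by omega, by omega, by omega⟩, bounded_compile _ (bound_reset p) (by omega) (by omega),
    trivial, ⟨by omega, by omega⟩, by simp⟩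

theorem bounded_program (p : Prog) {n l : ℕ} (hl : l < guessLabel p + n + 1) :
    (program p n l).Bounded (numRegs p) (guessLabel p + n + 1) := by
  have := four_le_numRegs p
  rcases l with _ | l
  · exact ⟨by omega, by omega⟩
  · rcases Nat.lt_or_ge l (fixedPart p).length with h | h
    · rw [program, List.getD_eq_getElem _ _ h]
      exact bounded_fixedPart p (by omega) _ (List.getElem_mem h)
    · rw [program, List.getD_eq_default _ _ h]
      exact ⟨by omega, by omega⟩

/-- The counters at the beginning of a round. -/
def base (s : ℕ) : ℕ → ℕ := update 0 1 s

/-- The counters when the input `n` has been written and `y` has been guessed. -/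
def guessed (n s y : ℕ) : ℕ → ℕ := update (update (base s) 0 n) 2 y

theorem guessed_apply (n s y r : ℕ) : guessed n s y r =
    if r = 2 then y else if r = 0 then n else if r = 1 then s else 0 := by
  simp only [guessed, base, update_apply, Pi.zero_apply]

theorem det_reset (p : Prog) (n : ℕ) {v : ℕ → ℕ} (hv : ∀ r, numRegs p ≤ r → v r = 0) :
    Det (program p n) (roundLabel p, v) (0, base (v 2)) :=
  (eval_reset p hv).det (program_layout p n).2.2.2.1

theorem det_input (p : Prog) {n s j : ℕ} (hj : j ≤ n) :
    Det (program p n) (guessLabel p + j, guessed (n - j) s 0) (guessLabel p, guessed n s 0) := by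
  induction j with
  | zero => exact .refl
  | succ j ih =>
    refine .head ?_ (ih (Nat.le_of_succ_le hj))
    have step : update (guessed (n - (j + 1)) s 0) 0 (n - (j + 1) + 1) = guessed (n - j) s 0 := by
      funext r
      simp only [update_apply, guessed_apply]
      split_ifs <;> omega
    simp [program_guessLabel_add_succ, Instr.next, guessed_apply, step]

theorem det_init (p : Prog) (n s : ℕ) :
    Det (program p n) (0, base s) (guessLabel p, guessed n s 0) := by
  refine .head ?_ (det_input p le_rfl)
  have start : base s = guessed 0 s 0 := by
    funext r
    simp only [base, update_apply, guessed_apply, Pi.zero_apply]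
    split_ifs <;> omega
  simp [program_zero, Instr.next, start]

/-- The program `p` decides the relation `T`, leaving the result in the register `3`. -/
def Decides (p : Prog) (T : ℕ → ℕ → ℕ → Prop) : Prop :=
  ∀ n s y, ∃ r, (r ≠ 0 ↔ T n s y) ∧ Eval p (guessed n s y) (update (guessed n s y) 3 r)

theorem Decides.det_of {p : Prog} {T : ℕ → ℕ → ℕ → Prop} (hp : Decides p T) {n s y : ℕ}
    (hT : T n s y) : ∃ v, v 2 = y ∧ (∀ r, numRegs p ≤ r → v r = 0) ∧
      Det (program p n) (2, guessed n s y) (roundLabel p, v) := by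
  have := four_le_numRegs p
  obtain ⟨r, hr, h⟩ := hp n s y
  obtain ⟨-, check, test, -⟩ := program_layout p n
  refine ⟨update (guessed n s y) 3 (r - 1), by simp [guessed], fun i hi => ?_,
    (h.det check).tail ?_⟩
  · simp only [update_apply, guessed_apply]
    split_ifs <;> omega
  · simp [test, Instr.next, hr.2 hT]

theorem Decides.det_of_not {p : Prog} {T : ℕ → ℕ → ℕ → Prop} (hp : Decides p T) {n s y : ℕ}
    (hT : ¬T n s y) : ∃ v, Det (program p n) (2, guessed n s y) (haltLabel p, v) := by
  obtain ⟨r, hr, h⟩ := hp n s y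
  obtain ⟨-, check, test, -⟩ := program_layout p n
  exact ⟨update (guessed n s y) 3 r,
    (h.det check).tail (by simp [test, Instr.next, not_not.1 (mt hr.1 hT)])⟩

theorem exists_decides {T : ℕ → ℕ → ℕ → Prop}
    (hT : PrimrecPred fun a : ℕ × ℕ × ℕ => T a.1 a.2.1 a.2.2) : ∃ p, Decides p T := by
  classical
  have get (i : Fin 3) : Primrec fun v : List.Vector ℕ 3 => v.get i :=
    Primrec.vector_get.comp .id (.const i)
  have indicator : Primrec fun v : List.Vector ℕ 3 =>
      if T (v.get 0) (v.get 1) (v.get 2) then 1 else 0 :=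
    Primrec.ite (hT.comp ((get 0).pair ((get 1).pair (get 2)))) (.const 1) (.const 0)
  obtain ⟨p, hp⟩ := Prog.computes_of_primrec' (Nat.Primrec'.prim_iff.2 indicator)
    (fun i => i.val) 3 4 (fun i => by omega) (by omega) (fun i => by omega)
  refine ⟨p, fun n s y => ⟨if T n s y then 1 else 0, by simp, ?_⟩⟩
  have h := hp (guessed n s y) fun r hr => by
    simp only [guessed_apply]
    split_ifs <;> omega
  simpa [guessed_apply] using h

end Search

end SearchPrograms

section CounterTapes

open Function

/-! ### Counters on tapes -/

/-- Tape symbols: a mark, which distinguishes the home cell, and one bit for each of `K` counters.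
The value of a counter is the number of consecutive bits `true` to the right of the home cell. -/
abbrev TSym (K : ℕ) : Type := Bool × (Fin K → Bool)

namespace TSym

variable {K : ℕ}

/-- The symbol stops the head on its way to the home cell: it is blank or marked. -/
def home (s : Option (TSym K)) : Bool := s.elim true Prod.fst

/-- The bit of the `i`-th counter. -/
def bitAt (s : Option (TSym K)) (i : ℕ) : Bool :=
  s.elim false fun a => if h : i < K then a.2 ⟨i, h⟩ else false

/-- The symbol with the mark only. -/
def mark : TSym K := (true, fun _ => false)

/-- The symbol without mark that has the same bits. -/
def unmark (s : Option (TSym K)) : TSym K := (false, fun i => bitAt s i)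

/-- The symbol without mark that has the bit `b` for the `i`-th counter, and otherwise the same
bits. -/
def setBit (s : Option (TSym K)) (i : ℕ) (b : Bool) : TSym K :=
  (false, fun j => if j.val = i then b else bitAt s j)

theorem some_unmark {s : Option (TSym K)} (hs : home s = false) : some (unmark s) = s := by
  rcases s with _ | ⟨b, f⟩
  · exact absurd hs (by simp [home])
  · obtain rfl : b = false := hs
    simp [unmark, bitAt]

theorem bitAt_update_unmark (R : ℕ → Option (TSym K)) (x y i : ℕ) :
    bitAt (update R x (some (unmark (R x))) y) i = bitAt (R y) i := by
  rcases eq_or_ne y x with rfl | h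
  · rw [update_self]
    cases R y <;> simp [bitAt, unmark]
  · rw [update_of_ne h]

theorem bitAt_update_setBit (R : ℕ → Option (TSym K)) (x y i : ℕ) {j : ℕ} (b : Bool) (hj : j < K) :
    bitAt (update R x (some (setBit (R x) i b)) y) j =
      if y = x ∧ j = i then b else bitAt (R y) j := by
  rcases eq_or_ne y x with rfl | h
  · simp [bitAt, setBit, hj]
  · rw [update_of_ne h, if_neg fun hy => h hy.1]

/-- The cell `p` of the tape `R` is the home cell, and the cells visited since it has been left are
those between `p` and `h`. -/
structure Frame (R : ℕ → Option (TSym K)) (p h : ℕ) : Prop where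
  pos : 1 ≤ p
  home : home (R p) = true
  nonblank : ∀ x, 1 ≤ x → x ≤ p → R x ≠ none
  clear : ∀ x, p < x → x < h → TSym.home (R x) = false

namespace Frame

variable {R : ℕ → Option (TSym K)} {p h h' x : ℕ}

theorem ne_none (H : Frame R p h) (hx : 1 ≤ x) (hxh : x < h) : R x ≠ none := by
  rcases Nat.lt_or_ge p x with hp | hp
  · intro hR
    have := H.clear x hp hxh
    rw [hR] at this
    exact absurd this (by simp [TSym.home])
  · exact H.nonblank x hx hp

theorem mono (H : Frame R p h) (hh : h' ≤ h) : Frame R p h' :=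
  ⟨H.pos, H.home, H.nonblank, fun x hp hx => H.clear x hp (hx.trans_le hh)⟩

theorem write {a : TSym K} (H : Frame R p h) (hp : p < x) (hx : x ≤ h) (ha : a.1 = false)
    (hh : h' ≤ max h (x + 1)) : Frame (update R x (some a)) p h' := by
  refine ⟨H.pos, ?_, fun y hy hyp => ?_, fun y hpy hyh => ?_⟩
  · rw [update_of_ne hp.ne]
    exact H.home
  · rw [update_of_ne (by omega)]
    exact H.nonblank y hy hyp
  · rw [update_apply]
    split_ifs with hyx
    · exact ha
    · exact H.clear y hpy (by omega)

theorem mark (hp : 1 ≤ p) (hleft : ∀ x, 1 ≤ x → x < p → R x ≠ none)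
    (hclear : ∀ x, p < x → x < h → TSym.home (R x) = false) :
    Frame (update R p (some TSym.mark)) p h := by
  refine ⟨hp, by rw [update_self]; rfl, fun x hx hxp => ?_, fun x hpx hxh => ?_⟩
  · rw [update_apply]
    split_ifs with h
    · exact Option.some_ne_none _
    · exact hleft x hx (by omega)
  · rw [update_of_ne hpx.ne']
    exact hclear x hpx hxh

end Frame

/-- The tape `R` with the home cell `p` contains the counter values `v`. -/
def Counts (R : ℕ → Option (TSym K)) (p : ℕ) (v : ℕ → ℕ) : Prop :=
  ∀ i < K, ∀ j ≤ v i, (bitAt (R (p + 1 + j)) i = true ↔ j < v i)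

namespace Counts

variable {R : ℕ → Option (TSym K)} {p : ℕ} {v : ℕ → ℕ}

theorem bitAt_end (H : Counts R p v) {i : ℕ} (hi : i < K) : bitAt (R (p + 1 + v i)) i = false :=
  Bool.eq_false_iff.2 fun h => ((H i hi _ le_rfl).1 h).ne rfl

theorem mark (H : Counts R p v) : Counts (update R p (some TSym.mark)) p v := fun i hi j hj => by
  rw [update_of_ne (by omega)]
  exact H i hi j hj

theorem unmark (H : Counts R p v) (x : ℕ) : Counts (update R x (some (unmark (R x)))) p v :=
  fun i hi j hj => by
    rw [bitAt_update_unmark]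
    exact H i hi j hj

theorem inc {R' : ℕ → Option (TSym K)} {i x : ℕ} (H : Counts R p v) (hx : x = p + 1 + v i)
    (hR' : R' = update R x (some (setBit (R x) i true))) :
    Counts (update R' (x + 1) (some (setBit (R' (x + 1)) i false))) p (update v i (v i + 1)) := by
  subst hx hR'
  intro j hj k hk
  have := H j hj k
  rw [bitAt_update_setBit _ _ _ _ _ hj, bitAt_update_setBit _ _ _ _ _ hj]
  rw [update_apply] at hk ⊢
  grind

theorem dec {i n : ℕ} (H : Counts R p v) (hn : v i = n + 1) :
    Counts (update R (p + 1 + n) (some (setBit (R (p + 1 + n)) i false))) p (update v i n) := by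
  intro j hj k hk
  have := H j hj k
  rw [bitAt_update_setBit _ _ _ _ _ hj]
  rw [update_apply] at hk ⊢
  grind

end Counts

/-- The transitions for the instruction with label `l` in the phase `ph` when `s` is read. In the
phase `0` the head moves left to the home cell, in the phase `1` it moves right to the end of a
counter, and the phase `2` handles the cell next to that end: to the right of it for `inc`, to the
left for `dec`, where it is the home cell if the counter is zero. -/
def trans (l : ℕ) (I : Instr) (ph : ℕ) (s : Option (TSym K)) : List (ℕ × TSym K × Dir) :=
  match ph, I with
  | 0, .halt => if home s then [] else [(3 * l, unmark s, .left)]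
  | 0, _ => if home s then [(3 * l + 1, mark, .right)] else [(3 * l, unmark s, .left)]
  | 1, .inc i _ => if bitAt s i then [(3 * l + 1, unmark s, .right)]
      else [(3 * l + 2, setBit s i true, .right)]
  | 1, .dec i _ _ => if bitAt s i then [(3 * l + 1, unmark s, .right)]
      else [(3 * l + 2, unmark s, .left)]
  | 1, .jump l₁ l₂ => [(3 * l₁, unmark s, .left), (3 * l₂, unmark s, .left)]
  | 2, .inc i l' => [(3 * l', setBit s i false, .left)]
  | 2, .dec i l₀ l₁ => if home s then [(3 * l₀, mark, .right)]
      else [(3 * l₁, setBit s i false, .left)]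
  | _, _ => []

theorem trans_bounded {l B ph : ℕ} {I : Instr} {s : Option (TSym K)} (hl : l < B)
    (hI : I.Bounded K B) : ∀ x ∈ trans l I ph s, x.1 < 3 * B := by
  unfold trans
  split <;> (try split_ifs) <;> simp [Instr.Bounded] at hI ⊢ <;> omega

variable (l : ℕ) {I : Instr} {s : Option (TSym K)}

theorem trans_zero_of_not_home (I : Instr) (hs : home s = false) :
    trans l I 0 s = [(3 * l, unmark s, .left)] := by
  cases I <;> simp [trans, hs]

theorem trans_zero_of_home (hI : I ≠ .halt) (hs : home s = true) :
    trans l I 0 s = [(3 * l + 1, mark, .right)] := by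
  cases I <;> simp [trans, hs] at hI ⊢

end TSym

end CounterTapes

section Simulation

open Function Relation TSym

/-! ### Simulation of counter machines by Turing machines -/

namespace NDTM

variable {M : NDTM} {K B : ℕ} {P : ℕ → Instr} {e : TSym K ≃ M.Symbol}

theorem Config.eq_none_of_le (C : M.Config) {x y : ℕ} (hx : 1 ≤ x) (hxy : x ≤ y)
    (h : C.t x = none) : C.t y = none := by
  induction y, hxy using Nat.le_induction with
  | base => exact h
  | succ y hxy ih =>
    rcases Nat.lt_or_ge y C.n with hy | hy
    · exact C.blank_succ y (hx.trans hxy) hy ih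
    · exact C.outside _ (.inr (Nat.lt_succ_of_le hy))

/-- The symbol in the cell `x`. -/
def read (e : TSym K ≃ M.Symbol) (C : M.Config) (x : ℕ) : Option (TSym K) := (C.t x).map e.symm

/-- The configuration `C'` arises from `C` by the transition to the state `x.1` that writes `x.2.1`
and moves the head in the direction `x.2.2`. -/
structure IsStep (e : TSym K ≃ M.Symbol) (C : M.Config) (x : ℕ × TSym K × Dir) (C' : M.Config) :
    Prop where
  n_eq : C'.n = C.n + 1
  t_eq : C'.t = update C.t C.p (some (e x.2.1))
  p_eq : C'.p = (match x.2.2 with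
      | Dir.left => C.p - 1
      | Dir.right => C.p + 1)
  q_eq : C'.q.val = x.1

namespace IsStep

variable {C C' C'' : M.Config} {x : ℕ × TSym K × Dir}

theorem read (h : IsStep e C x C') :
    NDTM.read e C' = update (NDTM.read e C) C.p (some x.2.1) := by
  funext y
  simp only [NDTM.read, h.t_eq, update_apply]
  split_ifs <;> simp

theorem unique (h' : IsStep e C x C') (h'' : IsStep e C x C'') : C' = C'' := by
  have n_eq := h'.n_eq.trans h''.n_eq.symm
  have t_eq := h'.t_eq.trans h''.t_eq.symm
  have p_eq := h'.p_eq.trans h''.p_eq.symm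
  have q_eq := Fin.ext (h'.q_eq.trans h''.q_eq.symm)
  cases C'
  cases C''
  simp only at n_eq t_eq p_eq q_eq
  subst n_eq t_eq p_eq q_eq
  rfl

end IsStep

theorem exists_isStep (e : TSym K ≃ M.Symbol) (C : M.Config) {x : ℕ × TSym K × Dir}
    (hq : x.1 < M.k + 1) (hd : x.2.2 = Dir.right ∨ 2 ≤ C.p)
    (hC : ∀ i, 1 ≤ i → i < C.p → read e C i ≠ none) : ∃ C', IsStep e C x C' := by
  have one_le := C.one_le_p
  have le_n := C.p_le_n
  refine ⟨⟨C.n + 1, update C.t C.p (some (e x.2.1)), (match x.2.2 with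
      | Dir.left => C.p - 1
      | Dir.right => C.p + 1), ⟨x.1, hq⟩, fun i hi => ?_, ?_, fun i hi _ hb => ?_, ?_, ?_⟩,
    rfl, rfl, rfl, rfl⟩
  · rw [update_of_ne (by omega)]
    exact C.outside i (by omega)
  · rw [update_of_ne (by omega)]
    exact C.outside _ (by omega)
  · have ne : i ≠ C.p := by
      rintro rfl
      simp at hb
    rw [update_of_ne ne] at hb
    have le : C.p ≤ i := not_lt.1 fun h => hC i hi h (by simp [read, hb])
    rw [update_of_ne (by omega)]
    exact C.eq_none_of_le hi (Nat.le_succ i) hb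
  · rcases hd with hd | hd
    · simp [hd]
    · cases x.2.2 <;> simp; omega
  · cases x.2.2 <;> simp <;> omega

/-- `M` simulates the counter machine `P` with `K` counters and `B` labels. The states `3 * l`,
`3 * l + 1` and `3 * l + 2` are the three phases of the instruction with label `l`. -/
structure Simulates (M : NDTM) (K B : ℕ) (P : ℕ → Instr) (e : TSym K ≃ M.Symbol) : Prop where
  states : M.k + 1 = 3 * B
  bounded : ∀ l < B, (P l).Bounded K B
  trans : ∀ s q r a d, (r, a, d) ∈ M.δ s q ↔
    (r.val, e.symm a, d) ∈ TSym.trans (q.val / 3) (P (q.val / 3)) (q.val % 3) (s.map e.symm)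

/-- `C'` is the only successor of `C`, and its state belongs to the instruction with label `l` or
begins the instruction with label `l'`. -/
def DetStep (l l' : ℕ) (C C' : M.Config) : Prop :=
  M.Next C = {C'} ∧ (C'.q.val / 3 = l ∨ C'.q.val = 3 * l')

/-- `M` is about to perform the instruction with label `l` on the counter values `v`. -/
structure At (e : TSym K ≃ M.Symbol) (C : M.Config) (l : ℕ) (v : ℕ → ℕ) : Prop where
  state : C.q.val = 3 * l
  home : TSym.home (read e C C.p) = true
  nonblank : ∀ x, 1 ≤ x → x < C.p → read e C x ≠ none
  counts : Counts (read e C) C.p v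

namespace Simulates

variable (S : Simulates M K B P e) {C : M.Config}
include S

theorem mem_next {C' : M.Config} : C' ∈ M.Next C ↔
    ∃ x ∈ TSym.trans (C.q.val / 3) (P (C.q.val / 3)) (C.q.val % 3) (read e C C.p),
      (x.2.2 = Dir.right ∨ 2 ≤ C.p) ∧ IsStep e C x C' := by
  constructor
  · rintro ⟨r, a, d, hδ, hd, hn, ht, hp, rfl⟩
    exact ⟨(C'.q.val, e.symm a, d), (S.trans _ _ _ _ _).1 hδ, hd, hn, by simpa using ht, hp, rfl⟩
  · rintro ⟨⟨r, a, d⟩, hx, hd, hn, ht, hp, rfl⟩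
    exact ⟨C'.q, e a, d, (S.trans _ _ _ _ _).2 (by simpa [read] using hx), hd, hn, ht, hp, rfl⟩

variable {l ph : ℕ} (hq : C.q.val = 3 * l + ph) (hph : ph < 3)
include hq hph

theorem label_lt : l < B := by
  have := S.states
  have := C.q.2
  omega

theorem mem_next_of_phase {C' : M.Config} : C' ∈ M.Next C ↔
    ∃ x ∈ TSym.trans l (P l) ph (read e C C.p),
      (x.2.2 = Dir.right ∨ 2 ≤ C.p) ∧ IsStep e C x C' := by
  rw [S.mem_next, show C.q.val / 3 = l by omega, show C.q.val % 3 = ph by omega]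

variable (hC : ∀ i, 1 ≤ i → i < C.p → read e C i ≠ none)
include hC

theorem exists_step {x : ℕ × TSym K × Dir} (hx : x ∈ TSym.trans l (P l) ph (read e C C.p))
    (hd : x.2.2 = Dir.right ∨ 2 ≤ C.p) : ∃ C', IsStep e C x C' := by
  have hl := S.label_lt hq hph
  exact exists_isStep e C (S.states ▸ trans_bounded hl (S.bounded l hl) x hx) hd hC

theorem exists_detStep {k l' : ℕ} {x : ℕ × TSym K × Dir}
    (hx : TSym.trans l (P l) ph (read e C C.p) = [x]) (hd : x.2.2 = Dir.right ∨ 2 ≤ C.p)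
    (hl' : x.1 / 3 = k ∨ x.1 = 3 * l') : ∃ C', DetStep k l' C C' ∧ IsStep e C x C' := by
  obtain ⟨C', h⟩ := S.exists_step hq hph hC (by rw [hx]; exact List.mem_singleton_self x) hd
  refine ⟨C', ⟨?_, by rwa [h.q_eq]⟩, h⟩
  ext C''
  rw [S.mem_next_of_phase hq hph, hx]
  simp only [List.mem_singleton, exists_eq_left, Set.mem_singleton_iff]
  exact ⟨fun h' => h'.2.unique h, fun h' => ⟨hd, h' ▸ h⟩⟩

end Simulates

namespace Simulates

variable (S : Simulates M K B P e) {C : M.Config} {l l' p i : ℕ} {v : ℕ → ℕ}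
include S

theorem exists_return {k : ℕ} (hq : C.q.val = 3 * l) (hp : p ≤ C.p)
    (F : Frame (read e C) p (C.p + 1)) (H : Counts (read e C) p v) :
    ∃ C', ReflTransGen (DetStep k l) C C' ∧ At e C' l v := by
  obtain ⟨d, hd⟩ := Nat.exists_eq_add_of_le hp
  induction d generalizing C with
  | zero =>
    obtain rfl : C.p = p := hd
    exact ⟨C, .refl, hq, F.home, fun x hx hxp => F.nonblank x hx hxp.le, H⟩
  | succ d ih =>
    have clear : home (read e C C.p) = false := F.clear C.p (by omega) (by omega)
    have := F.pos
    obtain ⟨C', step, h⟩ := S.exists_detStep (ph := 0) (k := k) hq (by decide)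
      (fun x hx hxp => F.ne_none hx (by omega)) (trans_zero_of_not_home l (P l) clear)
      (.inr (by omega)) (.inr rfl)
    have tape : read e C' = read e C := by rw [h.read, some_unmark clear, update_eq_self]
    have head : C'.p = C.p - 1 := h.p_eq
    obtain ⟨C'', path, H''⟩ := ih h.q_eq (by omega) (tape ▸ F.mono (by omega)) (tape ▸ H) (by omega)
    exact ⟨C'', .head step path, H''⟩

theorem exists_leave (hl : P l ≠ .halt) (H : At e C l v) :
    ∃ C', DetStep l l' C C' ∧ C'.q.val = 3 * l + 1 ∧ C'.p = C.p + 1 ∧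
      Frame (read e C') C.p C'.p ∧ Counts (read e C') C.p v := by
  obtain ⟨C', step, h⟩ := S.exists_detStep (ph := 0) (k := l) (l' := l') H.state (by decide)
    H.nonblank (trans_zero_of_home l hl H.home) (.inl rfl) (.inl (by dsimp only; omega))
  have head : C'.p = C.p + 1 := h.p_eq
  refine ⟨C', step, h.q_eq, head, ?_, ?_⟩ <;> rw [h.read]
  · exact .mark C.one_le_p H.nonblank fun x hpx hx => by omega
  · exact H.counts.mark

theorem exists_scan (hi : i < K)
    (hl : ∀ s : Option (TSym K), bitAt s i = true →
      TSym.trans l (P l) 1 s = [(3 * l + 1, unmark s, .right)])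
    (hq : C.q.val = 3 * l + 1) (hp : p < C.p) (hp' : C.p ≤ p + 1 + v i)
    (F : Frame (read e C) p C.p) (H : Counts (read e C) p v) :
    ∃ C', ReflTransGen (DetStep l l') C C' ∧ C'.q.val = 3 * l + 1 ∧ C'.p = p + 1 + v i ∧
      Frame (read e C') p C'.p ∧ Counts (read e C') p v := by
  obtain ⟨d, hd⟩ := Nat.exists_eq_add_of_le hp'
  induction d generalizing C with
  | zero => exact ⟨C, .refl, hq, hd.symm, F, H⟩
  | succ d ih =>
    have bit : bitAt (read e C C.p) i = true := by
      have := (H i hi (C.p - (p + 1)) (by omega)).2 (by omega)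
      rwa [Nat.add_sub_cancel' hp] at this
    obtain ⟨C', step, h⟩ := S.exists_detStep (k := l) (l' := l') hq (by decide)
      (fun x => F.ne_none) (hl _ bit) (.inl rfl) (.inl (by dsimp only; omega))
    have head : C'.p = C.p + 1 := h.p_eq
    obtain ⟨C'', path, H''⟩ := ih h.q_eq (by omega) (by omega)
      (by rw [h.read]; exact F.write hp le_rfl rfl (by omega)) (by rw [h.read]; exact H.unmark _)
      (by omega)
    exact ⟨C'', .head step path, H''⟩

theorem exists_counter_end (hi : i < K)
    (hP : (∃ l₁, P l = .inc i l₁) ∨ ∃ l₀ l₁, P l = .dec i l₀ l₁) (H : At e C l v) :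
    ∃ C', TransGen (DetStep l l') C C' ∧ C'.q.val = 3 * l + 1 ∧ C'.p = C.p + 1 + v i ∧
      Frame (read e C') C.p C'.p ∧ Counts (read e C') C.p v := by
  obtain ⟨C₁, step, hq, head, F, H⟩ := S.exists_leave (l' := l')
    (by rcases hP with ⟨_, h⟩ | ⟨_, _, h⟩ <;> simp [h]) H
  obtain ⟨C₂, path, H₂⟩ := S.exists_scan (l' := l') hi
    (fun s hs => by rcases hP with ⟨_, h⟩ | ⟨_, _, h⟩ <;> simp [TSym.trans, h, hs])
    hq (by omega) (by omega) F H
  exact ⟨C₂, .head' step path, H₂⟩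

theorem exists_at_of_inc (hi : i < K) (hP : P l = .inc i l') (H : At e C l v) :
    ∃ C', TransGen (DetStep l l') C C' ∧ At e C' l' (update v i (v i + 1)) := by
  obtain ⟨C₁, path₁, hq, head₁, F₁, H₁⟩ := S.exists_counter_end (l' := l') hi (.inl ⟨_, hP⟩) H
  have end_bit : bitAt (read e C₁ C₁.p) i = false := head₁ ▸ H₁.bitAt_end hi
  obtain ⟨C₂, step₂, h₂⟩ := S.exists_detStep (k := l) (l' := l') hq (by decide)
    (fun x => F₁.ne_none) (x := (3 * l + 2, setBit (read e C₁ C₁.p) i true, .right))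
    (by simp [TSym.trans, hP, end_bit]) (.inl rfl) (.inl (by dsimp only; omega))
  have head₂ : C₂.p = C₁.p + 1 := h₂.p_eq
  have F₂ : Frame (read e C₂) C.p C₂.p := by
    rw [h₂.read]
    exact F₁.write (by omega) le_rfl rfl (by omega)
  obtain ⟨C₃, step₃, h₃⟩ := S.exists_detStep (k := l) (l' := l') h₂.q_eq (by decide)
    (fun x => F₂.ne_none) (x := (3 * l', setBit (read e C₂ C₂.p) i false, .left))
    (by simp [TSym.trans, hP]) (.inr (by have := C₁.one_le_p; omega)) (.inr rfl)
  have head₃ : C₃.p = C₂.p - 1 := h₃.p_eq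
  have F₃ : Frame (read e C₃) C.p (C₃.p + 1) := by
    rw [h₃.read]
    exact F₂.write (by omega) le_rfl rfl (by omega)
  have H₃ : Counts (read e C₃) C.p (update v i (v i + 1)) := by
    rw [h₃.read, head₂]
    exact H₁.inc head₁ h₂.read
  obtain ⟨C₄, path₄, H₄⟩ := S.exists_return (k := l) h₃.q_eq (by omega) F₃ H₃
  exact ⟨C₄, ((path₁.tail step₂).tail step₃).trans_left path₄, H₄⟩

theorem exists_turn_of_dec {l₀ l₁ : ℕ} (hi : i < K) (hP : P l = .dec i l₀ l₁) (H : At e C l v) :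
    ∃ C', TransGen (DetStep l l') C C' ∧ C'.q.val = 3 * l + 2 ∧ C'.p = C.p + v i ∧
      Frame (read e C') C.p (C'.p + 2) ∧ Counts (read e C') C.p v := by
  obtain ⟨C₁, path₁, hq, head₁, F₁, H₁⟩ :=
    S.exists_counter_end (l' := l') hi (.inr ⟨_, _, hP⟩) H
  have end_bit : bitAt (read e C₁ C₁.p) i = false := head₁ ▸ H₁.bitAt_end hi
  have := C.one_le_p
  obtain ⟨C₂, step₂, h₂⟩ := S.exists_detStep (k := l) (l' := l') hq (by decide)
    (fun x => F₁.ne_none) (x := (3 * l + 2, unmark (read e C₁ C₁.p), .left))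
    (by simp [TSym.trans, hP, end_bit]) (.inr (by omega)) (.inl (by dsimp only; omega))
  have head₂ : C₂.p = C₁.p - 1 := h₂.p_eq
  refine ⟨C₂, path₁.tail step₂, h₂.q_eq, by omega, ?_, ?_⟩ <;> rw [h₂.read]
  · exact F₁.write (by omega) le_rfl rfl (by omega)
  · exact H₁.unmark _

theorem exists_at_of_dec_zero {l₁ : ℕ} (hi : i < K) (hP : P l = .dec i l' l₁) (hv : v i = 0)
    (H : At e C l v) : ∃ C', TransGen (DetStep l l') C C' ∧ At e C' l' v := by
  obtain ⟨C₁, path₁, hq, head₁, F₁, H₁⟩ := S.exists_turn_of_dec (l' := l') hi hP H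
  rw [hv, Nat.add_zero] at head₁
  have home : home (read e C₁ C₁.p) = true := head₁ ▸ F₁.home
  obtain ⟨C₂, step₂, h₂⟩ := S.exists_detStep (k := l) (l' := l') hq (by decide)
    (fun x hx hxp => F₁.ne_none hx (by omega)) (x := (3 * l', mark, .right))
    (by simp [TSym.trans, hP, home]) (.inl rfl) (.inr rfl)
  have head₂ : C₂.p = C₁.p + 1 := h₂.p_eq
  have F₂ : Frame (read e C₂) C.p (C₂.p + 1) := by
    rw [h₂.read, head₁]
    exact .mark F₁.pos (fun x hx hxp => F₁.nonblank x hx hxp.le)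
      fun x hpx hx => F₁.clear x hpx (by omega)
  have H₂ : Counts (read e C₂) C.p v := by
    rw [h₂.read, head₁]
    exact H₁.mark
  obtain ⟨C₃, path₃, H₃⟩ := S.exists_return (k := l) h₂.q_eq (by omega) F₂ H₂
  exact ⟨C₃, (path₁.tail step₂).trans_left path₃, H₃⟩

theorem exists_at_of_dec_succ {l₀ n : ℕ} (hi : i < K) (hP : P l = .dec i l₀ l') (hv : v i = n + 1)
    (H : At e C l v) : ∃ C', TransGen (DetStep l l') C C' ∧ At e C' l' (update v i n) := by
  obtain ⟨C₁, path₁, hq, head₁, F₁, H₁⟩ := S.exists_turn_of_dec (l' := l') hi hP H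
  replace head₁ : C₁.p = C.p + 1 + n := by omega
  have clear : home (read e C₁ C₁.p) = false := F₁.clear _ (by omega) (by omega)
  have := C.one_le_p
  obtain ⟨C₂, step₂, h₂⟩ := S.exists_detStep (k := l) (l' := l') hq (by decide)
    (fun x hx hxp => F₁.ne_none hx (by omega))
    (x := (3 * l', setBit (read e C₁ C₁.p) i false, .left))
    (by simp [TSym.trans, hP, clear]) (.inr (by omega)) (.inr rfl)
  have head₂ : C₂.p = C₁.p - 1 := h₂.p_eq
  have F₂ : Frame (read e C₂) C.p (C₂.p + 1) := by
    rw [h₂.read]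
    exact F₁.write (by omega) (by omega) rfl (by omega)
  have H₂ : Counts (read e C₂) C.p (update v i n) := by
    rw [h₂.read, head₁]
    exact H₁.dec hv
  obtain ⟨C₃, path₃, H₃⟩ := S.exists_return (k := l) h₂.q_eq (by omega) F₂ H₂
  exact ⟨C₃, (path₁.tail step₂).trans_left path₃, H₃⟩

theorem exists_at_of_jump {l₁ l₂ : ℕ} (hP : P l = .jump l₁ l₂) (H : At e C l v) :
    ∃ C' C₁ C₂, DetStep l l C C' ∧ M.Next C' = {C₁, C₂} ∧ At e C₁ l₁ v ∧ At e C₂ l₂ v := by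
  obtain ⟨C', step, hq, head, F, H'⟩ := S.exists_leave (l' := l) (by simp [hP]) H
  have := C.one_le_p
  have transitions : TSym.trans l (P l) 1 (read e C' C'.p) =
      [(3 * l₁, unmark (read e C' C'.p), .left), (3 * l₂, unmark (read e C' C'.p), .left)] := by
    simp [TSym.trans, hP]
  obtain ⟨C₁, h₁⟩ := S.exists_step (x := (3 * l₁, unmark (read e C' C'.p), .left)) hq (by decide)
    (fun x => F.ne_none) (by simp [transitions]) (.inr (by omega))
  obtain ⟨C₂, h₂⟩ := S.exists_step (x := (3 * l₂, unmark (read e C' C'.p), .left)) hq (by decide)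
    (fun x => F.ne_none) (by simp [transitions]) (.inr (by omega))
  have at_target {D : M.Config} {t : ℕ}
      (h : IsStep e C' (3 * t, unmark (read e C' C'.p), .left) D) : At e D t v := by
    have head' : D.p = C'.p - 1 := h.p_eq
    have back : D.p = C.p := by omega
    have F' : Frame (read e D) D.p (C'.p + 1) := by
      rw [h.read, back]
      exact F.write (by omega) le_rfl rfl (by omega)
    refine ⟨h.q_eq, F'.home, fun x hx hxp => F'.nonblank x hx hxp.le, ?_⟩
    rw [h.read, back]
    exact H'.unmark _
  refine ⟨C', C₁, C₂, step, ?_, at_target h₁, at_target h₂⟩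
  ext D
  rw [S.mem_next_of_phase hq (by decide), transitions]
  simp only [List.mem_cons, List.not_mem_nil, or_false, Set.mem_insert_iff, Set.mem_singleton_iff]
  constructor
  · rintro ⟨x, rfl | rfl, -, h⟩
    exacts [.inl (h.unique h₁), .inr (h.unique h₂)]
  · rintro (rfl | rfl)
    exacts [⟨_, .inl rfl, .inr (by omega), h₁⟩, ⟨_, .inr rfl, .inr (by omega), h₂⟩]

end Simulates

end NDTM

end Simulation

section InfiniteSequences

open Relation Filter

/-! ### Infinite computations -/

variable {α : Type*} {R : α → α → Prop} {Q : α → Prop} {a b : α}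

theorem exists_seq_of_forall_exists (ha : Q a) (h : ∀ a, Q a → ∃ b, Q b ∧ R a b) :
    ∃ f : ℕ → α, f 0 = a ∧ ∀ i, Q (f i) ∧ R (f i) (f (i + 1)) := by
  choose! g hQ hR using h
  have iterate (i : ℕ) : Q (g^[i] a) := by
    induction i with
    | zero => exact ha
    | succ i ih =>
      rw [Function.iterate_succ_apply']
      exact hQ _ ih
  refine ⟨fun i => g^[i] a, rfl, fun i => ⟨iterate i, ?_⟩⟩
  dsimp only
  rw [Function.iterate_succ_apply']
  exact hR _ (iterate i)

/-- Some `R`-path of length `n` leads from `a` to an element with the property `Q`. -/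
def ReachesIn (R : α → α → Prop) (Q : α → Prop) : ℕ → α → Prop
  | 0, a => Q a
  | n + 1, a => ∃ b, R a b ∧ ReachesIn R Q n b

theorem exists_reachesIn (h : ReflTransGen R a b) (hb : Q b) : ∃ n, ReachesIn R Q n a := by
  induction h using ReflTransGen.head_induction_on with
  | refl => exact ⟨0, hb⟩
  | head step _ ih => exact ih.imp' (· + 1) fun _ h => ⟨_, step, h⟩

theorem exists_seq_frequently (h : ∀ a, Q a → ∃ b, TransGen R a b ∧ Q b)
    (hab : ReflTransGen R a b) (hb : Q b) :
    ∃ c : ℕ → α, c 0 = a ∧ (∀ i, R (c i) (c (i + 1))) ∧ ∃ᶠ i in atTop, Q (c i) := by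
  have advance : ∀ x : ℕ × α, ReachesIn R Q x.1 x.2 →
      ∃ y : ℕ × α, ReachesIn R Q y.1 y.2 ∧ R x.2 y.2 ∧ (x.1 = 0 ∨ y.1 + 1 = x.1) := by
    rintro ⟨_ | n, a⟩ ha
    · obtain ⟨b, path, hb⟩ := h a ha
      obtain ⟨a', step, path'⟩ := TransGen.head'_iff.1 path
      obtain ⟨n, hn⟩ := exists_reachesIn path' hb
      exact ⟨(n, a'), hn, step, .inl rfl⟩
    · obtain ⟨b, step, hb⟩ := ha
      exact ⟨(n, b), hb, step, .inr rfl⟩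
  obtain ⟨n, hn⟩ := exists_reachesIn hab hb
  obtain ⟨f, hf0, hf⟩ := exists_seq_of_forall_exists (a := (n, a)) hn advance
  have arrives (m i : ℕ) (hm : (f i).1 = m) : ∃ j ≥ i, Q (f j).2 := by
    induction m generalizing i with
    | zero =>
      have reaches := (hf i).1
      rw [hm] at reaches
      exact ⟨i, le_rfl, reaches⟩
    | succ m ih =>
      obtain ⟨j, hj, hQ⟩ := ih (i + 1) (by have := (hf i).2.2; omega)
      exact ⟨j, Nat.le_of_succ_le hj, hQ⟩
  exact ⟨fun i => (f i).2, congrArg Prod.snd hf0, fun i => (hf i).2.1,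
    frequently_atTop.2 fun i => arrives _ i rfl⟩

end InfiniteSequences

section SimulatedComputations

open Function Relation TSym

namespace NDTM

variable {M : NDTM} {K B : ℕ} {P : ℕ → Instr} {e : TSym K ≃ M.Symbol}

/-- The configuration `C'` is a successor of `C`. -/
def Step (M : NDTM) (C C' : M.Config) : Prop := C' ∈ M.Next C

theorem DetStep.step {l l' : ℕ} {C C' : M.Config} (h : DetStep l l' C C') : M.Step C C' := by
  rw [Step, h.1]
  rfl

theorem exists_index_of_transGen {c : ℕ → M.Config} (hc : ∀ i, c (i + 1) ∈ M.Next (c i))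
    {i l l' : ℕ} {C : M.Config} (h : TransGen (DetStep l l') (c i) C) :
    ∃ i' > i, c i' = C ∧
      ∀ j, i < j → j ≤ i' → (c j).q.val / 3 = l ∨ (c j).q.val = 3 * l' := by
  have follow {j : ℕ} {D : M.Config} (h : DetStep l l' (c j) D) : c (j + 1) = D := by
    simpa [h.1] using hc j
  induction h with
  | single step =>
    refine ⟨i + 1, Nat.lt_succ_self i, follow step, fun j hij hj => ?_⟩
    obtain rfl : j = i + 1 := by omega
    exact follow step ▸ step.2
  | tail _ step ih =>
    obtain ⟨i', hi, rfl, labels⟩ := ih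
    refine ⟨i' + 1, Nat.lt_succ_of_lt hi, follow step, fun j hij hj => ?_⟩
    rcases Nat.of_le_succ hj with hj | rfl
    · exact labels j hij hj
    · exact follow step ▸ step.2

theorem ne_none_of_mem_next {C C' : M.Config} (h : C' ∈ M.Next C) {x : ℕ} (hx : 1 ≤ x)
    (hxp : x < C.p) : C.t x ≠ none := by
  obtain ⟨_, a, _, _, _, _, tape, _⟩ := h
  intro blank
  have blank' : C'.t C.p = none := by
    refine C'.eq_none_of_le hx hxp.le ?_
    rw [tape, update_of_ne hxp.ne, blank]
  rw [tape, update_self] at blank'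
  exact Option.some_ne_none a blank'

theorem exists_counts (e : TSym K ≃ M.Symbol) (C : M.Config) :
    ∃ v : ℕ → ℕ, (∀ r, K ≤ r → v r = 0) ∧ Counts (read e C) C.p v := by
  have ends (k : ℕ) : ∃ j, bitAt (read e C (C.p + 1 + j)) k = false := by
    refine ⟨C.n, ?_⟩
    rw [read, C.outside _ (by omega)]
    rfl
  refine ⟨fun k => if k < K then Nat.find (ends k) else 0, fun r hr => if_neg hr.not_gt,
    fun k hk j hj => ?_⟩
  simp only [hk, if_true] at hj ⊢
  rcases hj.lt_or_eq with hj | rfl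
  · simpa [hj] using Nat.find_min (ends k) hj
  · simp [Nat.find_spec (ends k)]

namespace Simulates

variable (S : Simulates M K B P e)
include S

theorem at_cases {C : M.Config} {l : ℕ} {v : ℕ → ℕ} (H : At e C l v) :
    P l = .halt ∨ (∃ l₁ l₂, P l = .jump l₁ l₂) ∨ ∃ l' v' C', (P l).next v = {(l', v')} ∧
      TransGen (DetStep l l') C C' ∧ At e C' l' v' := by
  have bounded := S.bounded l (S.label_lt (ph := 0) H.state (by decide))
  cases hP : P l with
  | halt => exact .inl rfl
  | jump l₁ l₂ => exact .inr (.inl ⟨l₁, l₂, rfl⟩)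
  | inc i l' =>
    rw [hP] at bounded
    obtain ⟨C', path, H'⟩ := S.exists_at_of_inc bounded.1 hP H
    exact .inr (.inr ⟨_, _, C', rfl, path, H'⟩)
  | dec i l₀ l₁ =>
    rw [hP] at bounded
    rcases hv : v i with _ | n
    · obtain ⟨C', path, H'⟩ := S.exists_at_of_dec_zero bounded.1 hP hv H
      exact .inr (.inr ⟨_, _, C', by simp [Instr.next, hv], path, H'⟩)
    · obtain ⟨C', path, H'⟩ := S.exists_at_of_dec_succ bounded.1 hP hv H
      exact .inr (.inr ⟨_, _, C', by simp [Instr.next, hv], path, H'⟩)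

theorem next_eq_empty {C : M.Config} {l : ℕ} {v : ℕ → ℕ} (H : At e C l v) (hP : P l = .halt) :
    M.Next C = ∅ := by
  ext C'
  rw [S.mem_next_of_phase (ph := 0) H.state (by decide)]
  simp [TSym.trans, hP, H.home]

theorem exists_transGen_at {C : M.Config} {l l' : ℕ} {v v' : ℕ → ℕ} (H : At e C l v)
    (hn : (l', v') ∈ (P l).next v) : ∃ C', TransGen M.Step C C' ∧ At e C' l' v' := by
  rcases S.at_cases H with hP | ⟨l₁, l₂, hP⟩ | ⟨l₁, v₁, C', next, path, H'⟩
  · rw [hP] at hn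
    exact hn.elim
  · obtain ⟨C', C₁, C₂, step, next, H₁, H₂⟩ := S.exists_at_of_jump hP H
    have step₁ : M.Step C' C₁ := by simp [Step, next]
    have step₂ : M.Step C' C₂ := by simp [Step, next]
    rw [hP] at hn
    obtain hn | hn := hn <;> cases hn
    exacts [⟨C₁, .head step.step (.single step₁), H₁⟩, ⟨C₂, .head step.step (.single step₂), H₂⟩]
  · rw [next] at hn
    cases hn
    exact ⟨C', TransGen.mono (fun _ _ => DetStep.step) _ _ path, H'⟩

theorem exists_reflTransGen_at {s t : ℕ × (ℕ → ℕ)} (hst : Instr.Det P s t) {C : M.Config}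
    (H : At e C s.1 s.2) : ∃ C', ReflTransGen M.Step C C' ∧ At e C' t.1 t.2 := by
  induction hst with
  | refl => exact ⟨C, .refl, H⟩
  | @tail _ t _ next ih =>
    obtain ⟨C₁, path₁, H₁⟩ := ih
    obtain ⟨C₂, path₂, H₂⟩ := S.exists_transGen_at (l' := t.1) (v' := t.2) H₁ (by rw [next]; rfl)
    exact ⟨C₂, path₁.trans path₂.to_reflTransGen, H₂⟩

variable {c : ℕ → M.Config} (hc : ∀ i, c (i + 1) ∈ M.Next (c i))
include hc

theorem exists_index_at_next {i l : ℕ} {v : ℕ → ℕ} (H : At e (c i) l v) :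
    ∃ i' > i, ∃ l' v', (l', v') ∈ (P l).next v ∧ At e (c i') l' v' ∧
      ∀ j, i < j → j ≤ i' → (c j).q.val / 3 = l ∨ (c j).q.val = 3 * l' := by
  rcases S.at_cases H with hP | ⟨l₁, l₂, hP⟩ | ⟨l', v', C', next, path, H'⟩
  · have := hc i
    rw [S.next_eq_empty H hP] at this
    exact this.elim
  · obtain ⟨C', C₁, C₂, step, next, H₁, H₂⟩ := S.exists_at_of_jump hP H
    obtain rfl : c (i + 1) = C' := by simpa [step.1] using hc i
    obtain ⟨t, ht, H'⟩ : ∃ t, (t, v) ∈ (P l).next v ∧ At e (c (i + 2)) t v := by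
      have := hc (i + 1)
      rw [next] at this
      rcases this with h | h
      exacts [⟨l₁, hP ▸ .inl rfl, h ▸ H₁⟩, ⟨l₂, hP ▸ .inr rfl, h ▸ H₂⟩]
    refine ⟨i + 2, by omega, t, v, ht, H', fun j hij hj => ?_⟩
    obtain rfl | rfl : j = i + 1 ∨ j = i + 2 := by omega
    · have := step.2
      omega
    · exact .inr H'.state
  · obtain ⟨i', hi, rfl, labels⟩ := exists_index_of_transGen hc path
    exact ⟨i', hi, l', v', next ▸ rfl, H', labels⟩

theorem exists_index_at_of_det {s t : ℕ × (ℕ → ℕ)} (hst : Instr.Det P s t) {i : ℕ}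
    (H : At e (c i) s.1 s.2) : ∃ i' ≥ i, At e (c i') t.1 t.2 := by
  induction hst with
  | refl => exact ⟨i, le_rfl, H⟩
  | tail _ next ih =>
    obtain ⟨i₁, hi₁, H₁⟩ := ih
    obtain ⟨i₂, hi₂, l', v', mem, H₂, -⟩ := S.exists_index_at_next hc H₁
    rw [next] at mem
    cases mem
    exact ⟨i₂, hi₁.trans hi₂.le, H₂⟩

theorem exists_index_at_of_state {i l : ℕ} (hq : (c i).q.val = 3 * l) :
    ∃ i' v, (∀ r, K ≤ r → v r = 0) ∧ At e (c i') l v := by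
  induction hp : (c i).p generalizing i with
  | zero => exact absurd (c i).one_le_p (by omega)
  | succ p ih =>
    cases hh : home (read e (c i) (c i).p) with
    | true =>
      obtain ⟨v, hv, counts⟩ := exists_counts e (c i)
      exact ⟨i, v, hv, hq, hh, fun x hx hxp => by
        simpa [read] using ne_none_of_mem_next (hc i) hx hxp, counts⟩
    | false =>
      have next := (S.mem_next_of_phase (ph := 0) hq (by decide)).1 (hc i)
      simp only [trans_zero_of_not_home l (P l) hh, List.mem_singleton, exists_eq_left] at next
      have head : (c (i + 1)).p = (c i).p - 1 := next.2.p_eq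
      exact ih next.2.q_eq (by omega)

end Simulates

end NDTM

end SimulatedComputations

section SearchMachines

open Function Relation Filter Instr NDTM

/-! ### Runs of search machines -/

namespace Search

theorem next_program_one (p : Prog) (n s y : ℕ) :
    (program p n 1).next (guessed n s y) = {(guessLabel p, guessed n s (y + 1))} := by
  simp [program_one, Instr.next, guessed]

theorem next_program_guessLabel (p : Prog) (n : ℕ) (v : ℕ → ℕ) :
    (program p n (guessLabel p)).next v = {(1, v), (2, v)} := by
  rw [program_guessLabel, Instr.next]

theorem at_start {K : ℕ} {M : NDTM} (e : TSym K ≃ M.Symbol) : At e (M.start []) 0 (base 0) := by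
  have blank (x : ℕ) : NDTM.read e (M.start []) x = none := by
    cases x <;> simp [NDTM.read, NDTM.start, NDTM.inputTape]
  refine ⟨rfl, by rw [blank]; rfl, fun x hx hx1 => absurd hx1 hx.not_gt, fun k _ j _ => ?_⟩
  simp [blank, base, TSym.bitAt]

variable {p : Prog} {T : ℕ → ℕ → ℕ → Prop} {M : NDTM} {n : ℕ} {e : TSym (numRegs p) ≃ M.Symbol}
  (S : Simulates M (numRegs p) (guessLabel p + n + 1) (program p n) e)
include S

section Soundness

variable {c : ℕ → M.Config} (hc : ∀ i, c (i + 1) ∈ M.Next (c i))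
include hc

theorem exists_index_at_check {i j s y : ℕ} (hij : i ≤ j) (hj : (c j).q.val = 3 * roundLabel p)
    (H : At e (c i) (guessLabel p) (guessed n s y)) :
    ∃ i' y', At e (c i') 2 (guessed n s y') := by
  induction hd : j - i using Nat.strong_induction_on generalizing i y with
  | _ d ih =>
    have labels_lt : 1 < roundLabel p ∧ roundLabel p < guessLabel p :=
      ⟨by unfold roundLabel testLabel; omega, roundLabel_lt_guessLabel p⟩
    obtain ⟨i₁, hi₁, l₁, v₁, next₁, H₁, labels₁⟩ := S.exists_index_at_next hc H
    rw [next_program_guessLabel] at next₁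
    obtain next₁ | next₁ := next₁ <;> cases next₁
    · obtain ⟨i₂, hi₂, l₂, v₂, next₂, H₂, labels₂⟩ := S.exists_index_at_next hc H₁
      rw [next_program_one] at next₂
      cases next₂
      have before : i₂ ≤ j := by
        by_contra! after
        have : i ≠ j := by
          rintro rfl
          have := H.state
          omega
        rcases Nat.lt_or_ge i₁ j with h | h
        · have := labels₂ j h after.le
          omega
        · have := labels₁ j (by omega) h
          omega
      exact ih (j - i₂) (by omega) before H₂ rfl
    · exact ⟨i₁, y, H₁⟩

theorem exists_index_at_round (hp : Decides p T)
    (recurs : ∃ᶠ i in atTop, (c i).q.val = 3 * roundLabel p) {i : ℕ} {u : ℕ → ℕ}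
    (hu : ∀ r, numRegs p ≤ r → u r = 0) (H : At e (c i) (roundLabel p) u) :
    ∃ i' u', (∀ r, numRegs p ≤ r → u' r = 0) ∧ At e (c i') (roundLabel p) u' ∧
      T n (u 2) (u' 2) := by
  obtain ⟨i₁, -, H₁⟩ :=
    S.exists_index_at_of_det hc ((det_reset p n hu).trans (det_init p n (u 2))) H
  obtain ⟨j, hj, state⟩ := frequently_atTop.1 recurs i₁
  obtain ⟨i₂, y, H₂⟩ := exists_index_at_check S hc hj state H₁
  by_cases hT : T n (u 2) y
  · obtain ⟨v, rfl, hv, det⟩ := hp.det_of hT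
    obtain ⟨i₃, -, H₃⟩ := S.exists_index_at_of_det hc det H₂
    exact ⟨i₃, v, hv, H₃, hT⟩
  · obtain ⟨v, det⟩ := hp.det_of_not hT
    obtain ⟨i₃, -, H₃⟩ := S.exists_index_at_of_det hc det H₂
    have := hc i₃
    rw [S.next_eq_empty H₃ (program_haltLabel p n)] at this
    exact this.elim

end Soundness

theorem exists_chain_of_recurs (hp : Decides p T) {qr : M.State} (hq : qr.val = 3 * roundLabel p)
    {c : ℕ → M.Config} (hc : M.Recurs qr c) : ∃ σ : ℕ → ℕ, ∀ i, T n (σ i) (σ (i + 1)) := by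
  have recurs : ∃ᶠ i in atTop, (c i).q.val = 3 * roundLabel p :=
    hc.2.mono fun i hi => by rw [hi, hq]
  obtain ⟨j, state⟩ := recurs.exists
  obtain ⟨i, u, hu, H⟩ := S.exists_index_at_of_state hc.1 state
  obtain ⟨g, -, hg⟩ := exists_seq_of_forall_exists (R := fun u u' : ℕ → ℕ => T n (u 2) (u' 2))
    (Q := fun u => (∀ r, numRegs p ≤ r → u r = 0) ∧ ∃ i, At e (c i) (roundLabel p) u)
    ⟨hu, i, H⟩ fun u ⟨hu, i, H⟩ => by
      obtain ⟨i', u', hu', H', hT⟩ := exists_index_at_round S hc.1 hp recurs hu H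
      exact ⟨u', ⟨hu', i', H'⟩, hT⟩
  exact ⟨fun i => g i 2, fun i => (hg i).2⟩

theorem exists_guess {s : ℕ} (y : ℕ) {C : M.Config}
    (H : At e C (guessLabel p) (guessed n s 0)) :
    ∃ C', ReflTransGen M.Step C C' ∧ At e C' (guessLabel p) (guessed n s y) := by
  induction y with
  | zero => exact ⟨C, .refl, H⟩
  | succ y ih =>
    obtain ⟨C₁, path₁, H₁⟩ := ih
    obtain ⟨C₂, path₂, H₂⟩ := S.exists_transGen_at (l' := 1) (v' := guessed n s y) H₁
      (by simp [next_program_guessLabel])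
    obtain ⟨C₃, path₃, H₃⟩ := S.exists_transGen_at H₂ (by rw [next_program_one]; rfl)
    exact ⟨C₃, path₁.trans (path₂.trans path₃).to_reflTransGen, H₃⟩

theorem exists_round (hp : Decides p T) {C : M.Config} {s y : ℕ} (H : At e C 0 (base s))
    (hT : T n s y) : ∃ C' C'', TransGen M.Step C C' ∧ C'.q.val = 3 * roundLabel p ∧
      ReflTransGen M.Step C' C'' ∧ At e C'' 0 (base y) := by
  obtain ⟨C₁, path₁, H₁⟩ := S.exists_reflTransGen_at (det_init p n s) H
  obtain ⟨C₂, path₂, H₂⟩ := exists_guess S y H₁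
  obtain ⟨C₃, path₃, H₃⟩ := S.exists_transGen_at (l' := 2) (v' := guessed n s y) H₂
    (by simp [next_program_guessLabel])
  obtain ⟨v, rfl, hv, det⟩ := hp.det_of hT
  obtain ⟨C₄, path₄, H₄⟩ := S.exists_reflTransGen_at det H₃
  obtain ⟨C₅, path₅, H₅⟩ := S.exists_reflTransGen_at (det_reset p n hv) H₄
  exact ⟨C₄, C₅, .trans_left (.trans_right (path₁.trans path₂) path₃) path₄, H₄.state, path₅, H₅⟩

theorem exists_recurs_of_chain (hp : Decides p T) {qr : M.State} (hq : qr.val = 3 * roundLabel p)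
    {σ : ℕ → ℕ} (h0 : σ 0 = 0) (hσ : ∀ i, T n (σ i) (σ (i + 1))) :
    ∃ c, c 0 = M.start [] ∧ M.Recurs qr c := by
  have again : ∀ C : M.Config,
      (C.q.val = 3 * roundLabel p ∧ ∃ i C', ReflTransGen M.Step C C' ∧ At e C' 0 (base (σ i))) →
      ∃ D : M.Config, TransGen M.Step C D ∧ D.q.val = 3 * roundLabel p ∧
        ∃ i C', ReflTransGen M.Step D C' ∧ At e C' 0 (base (σ i)) := by
    rintro C ⟨-, i, C', path, H⟩
    obtain ⟨D, D', path', state, rest, H'⟩ := exists_round S hp H (hσ i)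
    exact ⟨D, .trans_right path path', state, i + 1, D', rest, H'⟩
  obtain ⟨C, C', path, state, rest, H⟩ := exists_round S hp (at_start e) (h0 ▸ hσ 0)
  obtain ⟨c, start, steps, frequently⟩ :=
    exists_seq_frequently again path.to_reflTransGen ⟨state, 1, C', rest, H⟩
  exact ⟨c, start, steps, frequently.mono fun i hi => Fin.ext (hi.1.trans hq.symm)⟩

end Search

end SearchMachines

section Reductions

open Function TSym Encodable

/-! ### Descriptions of search machines -/

namespace NDTM

open Search

variable {K m : ℕ}

/-- The phases of the simulation of an instruction, together with the symbol that is read. -/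
noncomputable def situations (K : ℕ) : List (ℕ × Option (TSym K)) :=
  List.range 3 ×ˢ (Finset.univ : Finset (Option (TSym K))).toList

theorem mem_situations {ph : ℕ} {s : Option (TSym K)} : (ph, s) ∈ situations K ↔ ph < 3 := by
  simp [situations]

/-- The transitions that simulate the instruction `I` with label `l`. -/
noncomputable def labelTransitions (e : TSym K ≃ Fin (m + 2)) (l : ℕ) (I : Instr) :
    List Transition :=
  (situations K).flatMap fun x => (trans l I x.1 x.2).map fun y =>
    (3 * l + x.1, (x.2.map e).map Fin.val, y.1, (e y.2.1).val, y.2.2.isRight)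

theorem mem_labelTransitions (e : TSym K ≃ Fin (m + 2)) {l q r : ℕ} {I : Instr}
    {s : Option (Fin (m + 2))} {a : Fin (m + 2)} {d : Dir} :
    (q, s.map Fin.val, r, a.val, d.isRight) ∈ labelTransitions e l I ↔
      q / 3 = l ∧ (r, e.symm a, d) ∈ trans l I (q % 3) (s.map e.symm) := by
  simp only [labelTransitions, List.mem_flatMap, List.mem_map]
  constructor
  · rintro ⟨⟨ph, s'⟩, situation, ⟨r', a', d'⟩, mem, h⟩
    have hph := mem_situations.1 situation
    simp only [Prod.mk.injEq, Fin.val_inj] at h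
    obtain ⟨rfl, hs, rfl, rfl, hd⟩ := h
    obtain rfl := Option.map_injective Fin.val_injective hs
    obtain rfl : d' = d := by cases d <;> cases d' <;> simp_all [Dir.isRight]
    refine ⟨by omega, ?_⟩
    rw [Nat.mul_add_mod, Nat.mod_eq_of_lt hph]
    simpa using mem
  · rintro ⟨rfl, mem⟩
    refine ⟨(q % 3, s.map e.symm), mem_situations.2 (Nat.mod_lt _ (by omega)), _, mem, ?_⟩
    simp [Nat.div_add_mod]

theorem bounded_of_mem_labelTransitions (e : TSym K ≃ Fin (m + 2)) {l B k : ℕ} {I : Instr}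
    (hl : l < B) (hI : I.Bounded K B) (hB : 3 * B = k + 1) {y : Transition}
    (hy : y ∈ labelTransitions e l I) : y.Bounded k m := by
  simp only [labelTransitions, List.mem_flatMap, List.mem_map] at hy
  obtain ⟨⟨ph, s⟩, situation, z, mem, rfl⟩ := hy
  have hph := mem_situations.1 situation
  have target := trans_bounded hl hI z mem
  refine ⟨by dsimp only [Transition.source]; omega, ?_, by dsimp only [Transition.target]; omega,
    (e z.2.1).2⟩
  cases s with
  | none => simp
  | some s => have := (e s).2; simp

variable {p : Prog} (e : TSym (numRegs p) ≃ Fin (m + 2)) (n : ℕ)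

/-- The description of a Turing machine that performs the search program for the input `n`, with the
beginning of a round as distinguished state. -/
noncomputable def searchDescription : Description :=
  (3 * (guessLabel p + n) + 2, m, 3 * roundLabel p,
    (List.range (guessLabel p + n + 1)).flatMap fun l => labelTransitions e l (program p n l))

theorem valid_searchDescription : (searchDescription e n).Valid := by
  refine ⟨?_, fun y hy => ?_⟩
  · have := roundLabel_lt_guessLabel p
    change 3 * roundLabel p < 3 * (guessLabel p + n) + 2 + 1
    omega
  · obtain ⟨l, hl, hy⟩ := List.mem_flatMap.1 hy
    rw [List.mem_range] at hl
    exact bounded_of_mem_labelTransitions e hl (bounded_program p hl) rfl hy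

theorem simulates_searchDescription :
    Simulates (ofDescription (searchDescription e n)) (numRegs p) (guessLabel p + n + 1)
      (program p n) e := by
  refine ⟨rfl, fun l hl => bounded_program p hl, fun s q r a d => ?_⟩
  have hq : q.val < 3 * (guessLabel p + n) + 2 + 1 := q.2
  rw [mem_δ_ofDescription, transitionCode_mk]
  simp only [searchDescription, Description.transitions, List.mem_flatMap, List.mem_range]
  constructor
  · rintro ⟨l, -, mem⟩
    obtain ⟨rfl, mem⟩ := (mem_labelTransitions e).1 mem
    exact mem
  · intro mem
    exact ⟨q.val / 3, by omega, (mem_labelTransitions e).2 ⟨rfl, mem⟩⟩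

section Computability

variable {α : Type} [Primcodable α]

theorem primrec_flatMap_const {β γ : Type} [Primcodable γ] (L : List β) {f : α → β → List γ}
    (h : ∀ b ∈ L, Primrec fun a => f a b) : Primrec fun a => L.flatMap (f a) := by
  induction L with
  | nil => exact .const []
  | cons b L ih =>
    simp only [List.flatMap_cons]
    exact Primrec.list_append.comp (h b List.mem_cons_self)
      (ih fun b hb => h b (List.mem_cons_of_mem _ hb))

theorem primrec_three_mul {l : α → ℕ} (hl : Primrec l) : Primrec fun x => 3 * l x :=
  Primrec.nat_mul.comp (.const 3) hl

theorem primrec_add_const {l : α → ℕ} (hl : Primrec l) (c : ℕ) : Primrec fun x => l x + c :=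
  Primrec.nat_add.comp hl (.const c)

theorem primrec_transition_cons {q r : α → ℕ} (hq : Primrec q) (hr : Primrec r) (s : Option ℕ)
    (a : ℕ) (d : Bool) {L : α → List Transition} (hL : Primrec L) :
    Primrec fun x => ((q x, s, r x, a, d) : Transition) :: L x :=
  Primrec.list_cons.comp (hq.pair ((Primrec.const s).pair (hr.pair (.const (a, d))))) hL

theorem primrec_labelTransitions_jump (e : TSym K ≃ Fin (m + 2)) {l t t' : α → ℕ} (hl : Primrec l)
    (ht : Primrec t) (ht' : Primrec t') :
    Primrec fun x => labelTransitions e (l x) (.jump (t x) (t' x)) := by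
  refine primrec_flatMap_const _ fun ⟨ph, s⟩ situation => ?_
  have source := primrec_add_const (primrec_three_mul hl)
  have hph := mem_situations.1 situation
  interval_cases ph <;> simp only [TSym.trans] <;> try split_ifs
  all_goals simp only [List.map_cons, List.map_nil]
  · exact primrec_transition_cons (source 0) (source 1) _ _ _ (.const [])
  · exact primrec_transition_cons (source 0) (source 0) _ _ _ (.const [])
  · exact primrec_transition_cons (source 1) (primrec_three_mul ht) _ _ _
      (primrec_transition_cons (source 1) (primrec_three_mul ht') _ _ _ (.const []))
  · exact .const []

theorem primrec_labelTransitions_inc (e : TSym K ≃ Fin (m + 2)) {l t : α → ℕ} (hl : Primrec l)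
    (ht : Primrec t) (i : ℕ) : Primrec fun x => labelTransitions e (l x) (.inc i (t x)) := by
  refine primrec_flatMap_const _ fun ⟨ph, s⟩ situation => ?_
  have source := primrec_add_const (primrec_three_mul hl)
  have hph := mem_situations.1 situation
  interval_cases ph <;> simp only [TSym.trans] <;> try split_ifs
  all_goals simp only [List.map_cons, List.map_nil]
  · exact primrec_transition_cons (source 0) (source 1) _ _ _ (.const [])
  · exact primrec_transition_cons (source 0) (source 0) _ _ _ (.const [])
  · exact primrec_transition_cons (source 1) (source 1) _ _ _ (.const [])
  · exact primrec_transition_cons (source 1) (source 2) _ _ _ (.const [])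
  · exact primrec_transition_cons (source 2) (primrec_three_mul ht) _ _ _ (.const [])

theorem primrec_labelTransitions_program :
    Primrec fun x : ℕ × ℕ => labelTransitions e x.2 (program p x.1 x.2) := by
  have input : Primrec fun x : ℕ × ℕ => guessLabel p + x.1 := Primrec.nat_add.comp (.const _) .fst
  have fixed : Primrec fun x : ℕ × ℕ => ((List.range (guessLabel p + 1)).map fun l =>
      labelTransitions e l (program p 0 l)).getD x.2 [] :=
    (Primrec.list_getD []).comp (.const _) .snd
  refine (Primrec.ite (Primrec.eq.comp .snd (.const 0))
    (primrec_labelTransitions_jump e .snd input input)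
    (Primrec.ite (Primrec.nat_lt.comp .snd (.const (guessLabel p + 1))) fixed
      (primrec_labelTransitions_inc e .snd (Primrec.pred.comp .snd) 0))).of_eq fun ⟨n, l⟩ => ?_
  rcases l with _ | l
  · rfl
  · dsimp only
    rw [if_neg l.succ_ne_zero]
    split_ifs with fixed
    · simp only [List.getD_eq_getElem?_getD, List.getElem?_map, List.getElem?_range fixed]
      rfl
    · have beyond : (fixedPart p).length ≤ l := by
        rw [length_fixedPart]
        omega
      rw [program, List.getD_eq_default _ _ beyond]
      rfl

theorem primrec_searchDescription : Primrec (searchDescription e) := by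
  have last : Primrec fun n => guessLabel p + n := Primrec.nat_add.comp (.const _) .id
  exact (primrec_add_const (primrec_three_mul last) 2).pair ((Primrec.const m).pair
    ((Primrec.const _).pair (Primrec.list_flatMap
      (Primrec.list_range.comp (primrec_add_const last 1))
      (primrec_labelTransitions_program e).to₂)))

end Computability

end NDTM

open NDTM Search

theorem IsPi11.exists_reduction {B : Set ℕ} (hB : IsPi11 B) :
    ∃ (x : ℕ → Description) (hx : ∀ n, (x n).Valid), Primrec x ∧
      (∀ n ∈ B, (ofDescription (x n)).RobustNonRecurring ⟨(x n).state, (hx n).1⟩) ∧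
      ∀ n ∉ B, ¬(ofDescription (x n)).NonRecurringOn ⟨(x n).state, (hx n).1⟩ [] := by
  obtain ⟨T, hT, complete, sound⟩ := hB.exists_chain
  obtain ⟨p, hp⟩ := exists_decides hT
  obtain ⟨m, hm⟩ := Nat.exists_eq_add_of_le' (Fintype.one_lt_card (α := TSym (numRegs p)))
  let e := Fintype.equivFinOfCardEq hm
  refine ⟨searchDescription e, valid_searchDescription e, primrec_searchDescription e,
    fun n hn ρ => ?_, fun n hn h => ?_⟩
  · rw [nonRecurringFrom_iff]
    rintro ⟨c, -, recurs⟩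
    obtain ⟨σ, hσ⟩ := exists_chain_of_recurs (simulates_searchDescription e n) hp rfl recurs
    exact sound n σ hσ hn
  · rw [NonRecurringOn, nonRecurringFrom_iff] at h
    obtain ⟨σ, h0, hσ⟩ := complete n hn
    exact h (exists_recurs_of_chain (simulates_searchDescription e n) hp rfl h0 hσ)

theorem isPi11Complete_codesOf {P : (M : NDTM) → M.State → Prop} (hP : IsPi11 (codesOf P))
    (of_robust : ∀ M qr, M.RobustNonRecurring qr → P M qr)
    (on_nil : ∀ M qr, P M qr → M.NonRecurringOn qr []) : IsPi11Complete (codesOf P) := by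
  refine ⟨hP, fun B hB => ?_⟩
  obtain ⟨x, valid, primrec, positive, negative⟩ := hB.exists_reduction
  refine ⟨fun n => encode (x n), (Primrec.encode.comp primrec).to_comp, fun n => ?_⟩
  change n ∈ B ↔ encode (x n) ∈ codesOf P
  rw [mem_codesOf]
  constructor
  · exact fun hn => ⟨x n, rfl, valid n, of_robust _ _ (positive n hn)⟩
  · rintro ⟨y, hy, hyv, h⟩
    obtain rfl := encode_injective hy
    by_contra hn
    exact negative n hn (on_nil _ _ h)

end Reductions

theorem mainTheorem5 :
    IsPi11Complete (NDTM.codesOf fun M qr => M.NonRecurringOn qr []) ∧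
    IsPi11Complete (NDTM.codesOf fun M qr => M.UniversallyNonRecurring qr) ∧
    IsPi11Complete (NDTM.codesOf fun M qr => M.RobustNonRecurring qr) :=
  ⟨isPi11Complete_codesOf (NDTM.isPi11_nonRecurringOn [])
      (fun M _ h => h (M.start [])) (fun _ _ h => h),
    isPi11Complete_codesOf NDTM.isPi11_universallyNonRecurring
      (fun M _ h w => h (M.start w)) (fun _ _ h => h []),
    isPi11Complete_codesOf NDTM.isPi11_robustNonRecurring
      (fun _ _ h => h) (fun M _ h => h (M.start []))⟩
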